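/- **Conventions.** A $\lambda$-ring is a commutative unital ring $R$ with operations $\lambda^i\colon R\to R$ ($i\ge 0$) such that $\lambda^0(r)=1$, $\lambda^1(r)=r$, $\lambda^i(1)=0$ for $i>1$, $\lambda^i(r+s)=\sum_{k=0}^i\lambda^k(r)\lambda^{i-k}(s)$, $\lambda^i(rs)=P_i(\lambda^1(r),\dots,\lambda^i(r);\lambda^1(s),\dots,\lambda^i(s))$ and $\lambda^i(\lambda^j(r))=P_{i,j}(\lambda^1(r),\dots,\lambda^{ij}(r))$, with the usual universal integral polynomials $P_i$, $P_{i,j}$ (what is sometimes called a special $\lambda$-ring). A filtered $\lambda$-ring is a $\lambda$-ring with a decreasing sequence of ideals $I^n$ such that $\lambda^i(I^n)\subseteq I^n$ for all $n$ and all $i>0$. The Adams operations $\psi^n$ ($n\ge1$) are given by the Newton formula $\psi^n(r)-\lambda^1(r)\psi^{n-1}(r)+\cdots+(-1)^{n-1}\lambda^{n-1}(r)\psi^1(r)+(-1)^n n\lambda^n(r)=0$. Let $T$ be the set of positive integers and $\mathrm{End}(R)$ the ring of $\mathbf Z$-linear endomorphisms of $R$. Let $F^0(R)\subseteq \mathrm{End}(R)$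 consist of the $f$ with $f(r)^p\equiv f(r^p) \pmod{pR}$ for all primes $p$ and all $r\in R$; let $F^1(R)$ consist of the functions $f\colon T\to\mathrm{End}(R)$ with $f(p)(R)\subseteq pR$ for all primes $p$; and for $n\ge2$ let $F^n(R)$ be the set of all functions $T^n\to\mathrm{End}(R)$. The differential $d\colon F^n(R)\to F^{n+1}(R)$ is $$(df)(m_0,\dots,m_n)=\psi^{m_0}f(m_1,\dots,m_n)+\sum_{i=1}^n(-1)^if(m_0,\dots,m_{i-1}m_i,\dots,m_n)+(-1)^{n+1}f(m_0,\dots,m_{n-1})\psi^{m_n},$$ and $H^n_\lambda(R)$ is the $n$th cohomology group of this complex. The composition product $(f\circ g)(m_1,\dots,m_{n+k})=f(m_1,\dots,m_n)\circ g(m_{n+1},\dots,m_{n+k})$ induces a product on cohomology. Let $H_\lambda^{\le1}(R)=H^0_\lambda(R)\oplus H^1_\lambda(R)$ be the resulting graded algebra, in which products of two elements of degree $1$ are $0$. **Theorem.** Let $R$ be any filtered $\lambda$-ring whose underlying ring is (isomorphic to) the ring of dual numbers $\mathbf Z[x]/(x^2)$. Then there is an isomorphism of graded algebras $$H_\lambda^{\le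 1}(R)\;\cong\;\mathbf Z\oplus\mathbf Z\;\oplus\;\prod_{p\text{ prime}}(p\mathbf Z\oplus p\mathbf Z),$$ where on the right $\mathbf Z\oplus\mathbf Z$ is the part of degree $0$, the infinite product is the part of degree $1$, and the multiplication is given, for $(a,b),(c,d)\in\mathbf Z\oplus\mathbf Z$ and $\{(x_p,y_p)\}\in\prod_p(p\mathbf Z\oplus p\mathbf Z)$, by $$(a,b)\circ(c,d)=(ac,bd),\qquad (a,b)\circ\{(x_p,y_p)\}=\{(ax_p,by_p)\}=\{(x_p,y_p)\}\circ(a,b),$$ products of two elements of degree $1$ being $0$. In particular, $H_\lambda^{\le1}(R)$ is commutative. -/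

import Mathlib

namespace LambdaCohomology

/-! ### The universal polynomials -/

section UniversalPolynomials

open MvPolynomial Finset

/-- The coefficient of `t ^ i` in `∏_{m, n = 1}^i (1 + ξ_m η_n t)`, where `ξ_m` is the variable
`X (Sum.inl m)` and `η_n` is the variable `X (Sum.inr n)`. -/
noncomputable def prodCoeff (i : ℕ) : MvPolynomial (Fin i ⊕ Fin i) ℤ :=
  (∏ m : Fin i, ∏ n : Fin i,
    (1 + Polynomial.C (X (Sum.inl m) * X (Sum.inr n)) * Polynomial.X)).coeff i

/-- The elementary symmetric functions `s_1, …, s_i` of the `ξ`'s and `σ_1, …, σ_i` of the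
`η`'s. -/
noncomputable def prodEsymm (i : ℕ) : Fin i ⊕ Fin i → MvPolynomial (Fin i ⊕ Fin i) ℤ :=
  Sum.elim (fun k => rename Sum.inl (esymm (Fin i) ℤ (k + 1)))
    (fun k => rename Sum.inr (esymm (Fin i) ℤ (k + 1)))

theorem prod_one_add_mul_esymm {A : Type*} [CommRing A] (i : ℕ) (η : Fin i → A) (ξ : A) :
    ∏ n : Fin i, (1 + Polynomial.C (ξ * η n) * Polynomial.X) =
      1 + ∑ k : Fin i, Polynomial.C (aeval η (esymm (Fin i) ℤ (k + 1)) * ξ ^ (k + 1 : ℕ)) *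
        Polynomial.X ^ (k + 1 : ℕ) := by
  rw [Finset.prod_one_add, Finset.sum_powerset, Finset.sum_range_succ', add_comm]
  congr 1
  · simp
  · rw [Finset.card_fin, Finset.sum_range]
    refine Finset.sum_congr rfl fun k _ => ?_
    rw [esymm, map_sum, Finset.sum_mul, map_sum, Finset.sum_mul]
    refine Finset.sum_congr rfl fun s hs => ?_
    rw [Finset.prod_mul_distrib, Finset.prod_const, (Finset.mem_powersetCard.1 hs).2, ← map_prod,
      Finset.prod_mul_distrib, Finset.prod_const, (Finset.mem_powersetCard.1 hs).2, map_prod]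
    simp [mul_comm]

theorem exists_iteratedProdPoly (i : ℕ) :
    ∃ Q : MvPolynomial (Fin i) (MvPolynomial (Fin i) ℤ),
      aeval (fun k : Fin i => esymm (Fin i) (MvPolynomial (Fin i) ℤ) (k + 1)) Q =
        (∏ m : Fin i, (1 + ∑ k : Fin i, Polynomial.C (C (X k) * X m ^ (k + 1 : ℕ)) *
          Polynomial.X ^ (k + 1 : ℕ)) :
          Polynomial (MvPolynomial (Fin i) (MvPolynomial (Fin i) ℤ))).coeff i := by
  have hq : MvPolynomial.IsSymmetric
      ((∏ m : Fin i, (1 + ∑ k : Fin i, Polynomial.C (C (X k) * X m ^ (k + 1 : ℕ)) *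
          Polynomial.X ^ (k + 1 : ℕ)) :
          Polynomial (MvPolynomial (Fin i) (MvPolynomial (Fin i) ℤ))).coeff i) := by
    intro e
    have h1 : ∀ p : Polynomial (MvPolynomial (Fin i) (MvPolynomial (Fin i) ℤ)),
        rename e (p.coeff i) = (p.map (rename e).toRingHom).coeff i := by
      intro p; rw [Polynomial.coeff_map]; rfl
    rw [h1, Polynomial.map_prod]
    conv_rhs => rw [← Equiv.prod_comp e]
    congr 1
    refine Finset.prod_congr rfl fun m _ => ?_
    simp [Polynomial.map_sum]
  obtain ⟨Q, hQ⟩ := esymmAlgHom_surjective (σ := Fin i) (n := i) (MvPolynomial (Fin i) ℤ)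
    (by simp) ⟨_, hq⟩
  exact ⟨Q, by rw [← esymmAlgHom_apply, hQ]⟩

theorem exists_iteratedHom (i : ℕ) :
    ∃ φ : MvPolynomial (Fin i) (MvPolynomial (Fin i) ℤ) →ₐ[ℤ] MvPolynomial (Fin i ⊕ Fin i) ℤ,
      (∀ m, φ (X m) = X (Sum.inl m)) ∧ ∀ k, φ (C (X k)) = prodEsymm i (Sum.inr k) := by
  refine ⟨(aeval (Sum.elim (fun m => X (Sum.inl m)) (fun k => prodEsymm i (Sum.inr k)))).comp
    (sumAlgEquiv ℤ (Fin i) (Fin i)).symm.toAlgHom, fun m => ?_, fun k => ?_⟩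
  · simp
  · simp

theorem coeff_map_prod_factor {A B : Type*} [CommRing A] [CommRing B] (i : ℕ) (φ : A →+* B)
    (c x : Fin i → A) (ξ η : Fin i → B) (hx : ∀ m, φ (x m) = ξ m)
    (hc : ∀ k : Fin i, φ (c k) = aeval η (esymm (Fin i) ℤ (k + 1))) :
    φ ((∏ m : Fin i, (1 + ∑ k : Fin i, Polynomial.C (c k * x m ^ (k + 1 : ℕ)) *
      Polynomial.X ^ (k + 1 : ℕ))).coeff i) =
    (∏ m : Fin i, ∏ n : Fin i, (1 + Polynomial.C (ξ m * η n) * Polynomial.X)).coeff i := by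
  rw [← Polynomial.coeff_map, Polynomial.map_prod]
  congr 1
  refine Finset.prod_congr rfl fun m _ => ?_
  rw [prod_one_add_mul_esymm i η (ξ m)]
  simp only [Polynomial.map_add, Polynomial.map_one, Polynomial.map_sum, Polynomial.map_mul,
    Polynomial.map_pow, Polynomial.map_C, Polynomial.map_X]
  congr 1
  refine Finset.sum_congr rfl fun k _ => ?_
  rw [map_mul, map_pow, hx, hc]

theorem exists_prodPoly (i : ℕ) :
    ∃ P : MvPolynomial (Fin i ⊕ Fin i) ℤ, aeval (prodEsymm i) P = prodCoeff i := by
  obtain ⟨Q, hQ⟩ := exists_iteratedProdPoly i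
  obtain ⟨φ, hφX, hφC⟩ := exists_iteratedHom i
  have h3 := congrArg φ hQ
  have h4 : φ.comp (((aeval (fun k : Fin i => esymm (Fin i) (MvPolynomial (Fin i) ℤ)
      (k + 1))).restrictScalars ℤ).comp (sumAlgEquiv ℤ (Fin i) (Fin i)).toAlgHom) =
      aeval (prodEsymm i) := by
    refine MvPolynomial.algHom_ext fun k => ?_
    rcases k with k | k
    · have : φ (esymm (Fin i) (MvPolynomial (Fin i) ℤ) (k + 1)) = prodEsymm i (Sum.inl k) := by
        simp only [esymm, prodEsymm, Sum.elim_inl, map_sum, map_prod, hφX, rename_X]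
      simpa using this
    · simpa using hφC k
  refine ⟨(sumAlgEquiv ℤ (Fin i) (Fin i)).symm Q, ?_⟩
  have h5 := DFunLike.congr_fun h4 ((sumAlgEquiv ℤ (Fin i) (Fin i)).symm Q)
  rw [← h5]
  have h7 : (sumAlgEquiv ℤ (Fin i) (Fin i)).toAlgHom ((sumAlgEquiv ℤ (Fin i) (Fin i)).symm Q) =
      Q := AlgEquiv.apply_symm_apply _ _
  simp only [AlgHom.comp_apply, h7, AlgHom.restrictScalars_apply]
  rw [h3]
  refine coeff_map_prod_factor i φ.toRingHom (fun k => C (X k)) X _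
    (fun n => X (Sum.inr n)) hφX fun k => (hφC k).trans ?_
  simp only [esymm, prodEsymm, Sum.elim_inr, map_sum, map_prod, rename_X, aeval_X]

/-- The universal polynomial `P_i`: `P_i (s_1, …, s_i; σ_1, …, σ_i)` is the coefficient of
`t ^ i` in `∏_{m, n} (1 + ξ_m η_n t)`. -/
noncomputable def prodPoly (i : ℕ) : MvPolynomial (Fin i ⊕ Fin i) ℤ :=
  (exists_prodPoly i).choose

theorem aeval_prodPoly (i : ℕ) : aeval (prodEsymm i) (prodPoly i) = prodCoeff i :=
  (exists_prodPoly i).choose_spec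

/-- The coefficient of `t ^ i` in `∏_{l_1 < ⋯ < l_j} (1 + ξ_{l_1} ⋯ ξ_{l_j} t)`, in the variables
`ξ_1, …, ξ_{ij}`. -/
noncomputable def compCoeff (i j : ℕ) : MvPolynomial (Fin (i * j)) ℤ :=
  (∏ s ∈ powersetCard j (univ : Finset (Fin (i * j))),
    (1 + Polynomial.C (∏ l ∈ s, X l) * Polynomial.X)).coeff i

theorem exists_compPoly (i j : ℕ) :
    ∃ P : MvPolynomial (Fin (i * j)) ℤ,
      aeval (fun k : Fin (i * j) => esymm (Fin (i * j)) ℤ (k + 1)) P = compCoeff i j := by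
  classical
  have hq : (compCoeff i j).IsSymmetric := by
    intro e
    have h1 : ∀ p : Polynomial (MvPolynomial (Fin (i * j)) ℤ),
        rename e (p.coeff i) = (p.map (rename e).toRingHom).coeff i := by
      intro p; rw [Polynomial.coeff_map]; rfl
    rw [compCoeff, h1, Polynomial.map_prod]
    congr 1
    refine Finset.prod_bij' (fun s _ => s.map e.toEmbedding) (fun s _ => s.map e.symm.toEmbedding)
      ?_ ?_ ?_ ?_ ?_
    · intro s hs; simpa [mem_powersetCard] using hs
    · intro s hs; simpa [mem_powersetCard] using hs
    · intro s _; simp [Finset.map_map]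
    · intro s _; simp [Finset.map_map]
    · intro s _; simp [Polynomial.map_prod]
  obtain ⟨Q, hQ⟩ := esymmAlgHom_surjective (σ := Fin (i * j)) (n := i * j) ℤ (by simp)
    ⟨compCoeff i j, hq⟩
  exact ⟨Q, by rw [← esymmAlgHom_apply, hQ]⟩

/-- The universal polynomial `P_{i,j}`: `P_{i,j} (s_1, …, s_{ij})` is the coefficient of `t ^ i`
in `∏_{l_1 < ⋯ < l_j} (1 + ξ_{l_1} ⋯ ξ_{l_j} t)`. -/
noncomputable def compPoly (i j : ℕ) : MvPolynomial (Fin (i * j)) ℤ :=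
  (exists_compPoly i j).choose

theorem aeval_compPoly (i j : ℕ) :
    aeval (fun k : Fin (i * j) => esymm (Fin (i * j)) ℤ (k + 1)) (compPoly i j) =
      compCoeff i j :=
  (exists_compPoly i j).choose_spec

end UniversalPolynomials


/-! ### `λ`-rings and Adams operations -/

/-- A `λ`-ring structure on a commutative ring (a "special" `λ`-ring in another terminology). The
variable with index `k : Fin n` of a universal polynomial stands for the `(k + 1)`-st elementary
symmetric function, and `λ^{k + 1}` is substituted for it. -/
class LambdaRing (R : Type*) [CommRing R] where
  /-- The operation `λ^i`. -/
  lam : ℕ → R → R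
  lam_zero : ∀ r, lam 0 r = 1
  lam_one : ∀ r, lam 1 r = r
  lam_apply_one : ∀ i, 1 < i → lam i 1 = 0
  lam_add : ∀ i r s, lam i (r + s) = ∑ k ∈ Finset.range (i + 1), lam k r * lam (i - k) s
  lam_mul : ∀ i r s, lam i (r * s) =
    MvPolynomial.aeval (Sum.elim (fun k : Fin i => lam (k + 1) r) (fun k : Fin i => lam (k + 1) s))
      (prodPoly i)
  lam_lam : ∀ i j r, lam i (lam j r) =
    MvPolynomial.aeval (fun k : Fin (i * j) => lam (k + 1) r) (compPoly i j)

/-- A filtered `λ`-ring structure on a commutative ring: a `λ`-ring structure together with a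
decreasing sequence of ideals that are closed under the operations `λ^i`, `i > 0`. -/
class FilteredLambdaRing (R : Type*) [CommRing R] extends LambdaRing R where
  /-- The filtration ideals `I^n`. -/
  filtration : ℕ → Ideal R
  filtration_antitone : Antitone filtration
  lam_mem_filtration : ∀ n i, 0 < i → ∀ r ∈ filtration n, lam i r ∈ filtration n

open LambdaRing

section Adams

variable {R : Type*} [CommRing R] [LambdaRing R]

/-- The Adams operation `ψ^n`, `n ≥ 1`, defined inductively by the Newton formula
`ψ^n(r) - λ^1(r) ψ^{n-1}(r) + ⋯ + (-1)^{n-1} λ^{n-1}(r) ψ^1(r) + (-1)^n n λ^n(r) = 0`.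
(The value for `n = 0` is not used.) -/
def adamsFun (n : ℕ) (r : R) : R :=
  -((-1) ^ n * n * lam n r +
    ∑ i : Fin (n - 1), (-1) ^ (i + 1 : ℕ) * lam (i + 1) r * adamsFun (n - (i + 1)) r)
termination_by n
decreasing_by omega

/-- The Newton formula. -/
theorem newton (n : ℕ) (r : R) :
    ∑ i ∈ Finset.range (n + 1), (-1) ^ i * lam i r * adamsFun (n + 1 - i) r +
      (-1) ^ (n + 1) * (n + 1 : ℕ) * lam (n + 1) r = 0 := by
  rw [Finset.sum_range_succ']
  simp only [pow_zero, lam_zero, one_mul, Nat.sub_zero]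
  have h : adamsFun (n + 1) r = -((-1) ^ (n + 1) * (n + 1 : ℕ) * lam (n + 1) r +
      ∑ i : Fin n, (-1) ^ (i + 1 : ℕ) * lam (i + 1) r * adamsFun (n + 1 - (i + 1)) r) := by
    rw [adamsFun]
    rfl
  rw [h, Finset.sum_range]
  ring

/-- The generating series `∑ λ^n(r) t^n`. -/
noncomputable def lamSeries (r : R) : PowerSeries R := PowerSeries.mk fun n => lam n r

/-- The generating series `∑ (-1)^n ψ^{n+1}(r) t^n`. -/
noncomputable def adamsSeries (r : R) : PowerSeries R :=
  PowerSeries.mk fun n => (-1) ^ n * adamsFun (n + 1) r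

theorem lamSeries_add (r s : R) : lamSeries (r + s) = lamSeries r * lamSeries s := by
  ext n
  rw [PowerSeries.coeff_mul, Finset.Nat.sum_antidiagonal_eq_sum_range_succ_mk]
  simp [lamSeries, lam_add]

theorem lamSeries_mul_adamsSeries (r : R) :
    lamSeries r * adamsSeries r = PowerSeries.derivative R (lamSeries r) := by
  ext n
  rw [PowerSeries.coeff_derivative, PowerSeries.coeff_mul,
    Finset.Nat.sum_antidiagonal_eq_sum_range_succ_mk]
  simp only [lamSeries, adamsSeries, PowerSeries.coeff_mk]
  have h := congrArg (fun z => (-1) ^ n * z) (newton n r)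
  simp only [mul_add, mul_zero, Finset.mul_sum] at h
  have h1 : ∀ k ∈ Finset.range (n + 1), lam k r * ((-1) ^ (n - k) * adamsFun (n - k + 1) r) =
      (-1) ^ n * ((-1) ^ k * lam k r * adamsFun (n + 1 - k) r) := by
    intro k hk
    have hk' : k ≤ n := Nat.lt_succ_iff.1 (Finset.mem_range.1 hk)
    obtain ⟨m, rfl⟩ := Nat.exists_eq_add_of_le hk'
    have h2 : ((-1 : R) ^ k) * (-1) ^ k = 1 := by
      rw [← mul_pow]; simp
    rw [show k + m - k = m by omega, show k + m + 1 - k = m + 1 by omega, pow_add]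
    linear_combination (-(lam k r * (-1) ^ m * adamsFun (m + 1) r)) * h2
  rw [Finset.sum_congr rfl h1]
  have h3 : ((-1 : R) ^ n) * (-1) ^ n = 1 := by
    rw [← mul_pow]; simp
  push_cast at h ⊢
  rw [pow_succ] at h
  linear_combination h + (n + 1) * lam (n + 1) r * h3

theorem adamsSeries_add (r s : R) : adamsSeries (r + s) = adamsSeries r + adamsSeries s := by
  have hu : ∀ r : R, IsUnit (lamSeries r) := fun r => by
    rw [PowerSeries.isUnit_iff_constantCoeff]
    simp [lamSeries, lam_zero, ← PowerSeries.coeff_zero_eq_constantCoeff_apply]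
  refine (hu (r + s)).mul_left_cancel ?_
  rw [lamSeries_mul_adamsSeries, lamSeries_add, Derivation.leibniz, smul_eq_mul, smul_eq_mul,
    ← lamSeries_mul_adamsSeries, ← lamSeries_mul_adamsSeries]
  ring

theorem adamsFun_add (n : ℕ+) (r s : R) :
    adamsFun n (r + s) = adamsFun n r + adamsFun n s := by
  obtain ⟨m, hm⟩ : ∃ m, (n : ℕ) = m + 1 := ⟨n - 1, by have := n.pos; omega⟩
  have h := congrArg (PowerSeries.coeff m) (adamsSeries_add r s)
  simp only [adamsSeries, PowerSeries.coeff_mk, map_add, ← mul_add] at h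
  rw [hm]
  exact ((isUnit_one.neg).pow m).mul_left_cancel h

variable (R) in
/-- The Adams operation `ψ^n`, `n ≥ 1`, as a `ℤ`-linear map. -/
def adams (n : ℕ+) : Module.End ℤ R :=
  (AddMonoidHom.mk' (adamsFun (n : ℕ)) (adamsFun_add n)).toIntLinearMap

end Adams

/-! ### The cochain complex and its cohomology -/

section Complex

variable (R : Type*) [CommRing R]

/-- The algebra of `ℤ`-linear endomorphisms `f` of `R` with `f(r)^p ≡ f(r^p)` modulo `pR` for every
prime `p` and every `r`. -/
def endBar : Subring (Module.End ℤ R) where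
  carrier := {f | ∀ p : ℕ, p.Prime → ∀ r : R, (p : R) ∣ f r ^ p - f (r ^ p)}
  one_mem' := fun p _ r => by simp
  zero_mem' := fun p hp r => by simp [hp.ne_zero]
  mul_mem' := by
    intro f g hf hg p hp r
    have h1 := hf p hp (g r)
    obtain ⟨c, hc⟩ := hg p hp r
    have h2 : f (g r ^ p) - f (g (r ^ p)) = p * f c := by
      rw [← map_sub, hc, ← nsmul_eq_mul, map_nsmul, nsmul_eq_mul]
    have h3 : (p : R) ∣ f (g r ^ p) - f (g (r ^ p)) := ⟨_, h2⟩
    simpa [Module.End.mul_apply] using dvd_add h1 h3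
  add_mem' := by
    intro f g hf hg p hp r
    obtain ⟨c, hc⟩ := exists_add_pow_prime_eq hp (f r) (g r)
    have h := dvd_add (hf p hp r) (hg p hp r)
    have h2 : (f + g) r ^ p - (f + g) (r ^ p) =
        (f r ^ p - f (r ^ p) + (g r ^ p - g (r ^ p))) + p * (f r * g r * c) := by
      rw [LinearMap.add_apply, LinearMap.add_apply, hc]; ring
    rw [h2]
    exact dvd_add h (dvd_mul_right _ _)
  neg_mem' := by
    intro f hf p hp r
    have h := hf p hp r
    rw [LinearMap.neg_apply, LinearMap.neg_apply]
    rcases hp.eq_two_or_odd' with rfl | hodd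
    · have h2 : (-f r) ^ 2 - -f (r ^ 2) = (f r ^ 2 - f (r ^ 2)) + ((2 : ℕ) : R) * f (r ^ 2) := by
        push_cast; ring
      rw [h2]
      exact dvd_add h (dvd_mul_right _ _)
    · rw [hodd.neg_pow]
      have h2 : -f r ^ p - -f (r ^ p) = -(f r ^ p - f (r ^ p)) := by ring
      rw [h2]
      exact (dvd_neg).2 h

/-- All functions `T^n → End(R)`, where `T` is the set of positive integers. -/
abbrev Fun (n : ℕ) : Type _ := (Fin n → ℕ+) → Module.End ℤ R

/-- The group of cochains `F^n`: for `n = 0` the (unique) value has to lie in `endBar R`, for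
`n = 1` one requires `f(p)(R) ⊆ pR` for each prime `p`, and for `n ≥ 2` there is no condition. -/
def cochains : (n : ℕ) → AddSubgroup (Fun R n)
  | 0 => (endBar R).toAddSubgroup.comap (Pi.evalAddMonoidHom _ ![])
  | 1 =>
    { carrier := {f | ∀ p : ℕ+, (p : ℕ).Prime → ∀ r : R, ((p : ℕ) : R) ∣ f ![p] r}
      zero_mem' := fun p _ r => by simp
      add_mem' := fun hf hg p hp r => by simpa using dvd_add (hf p hp r) (hg p hp r)
      neg_mem' := fun hf p hp r => by simpa using hf p hp r }
  | _ + 2 => ⊤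

variable [LambdaRing R]

/-- The differential
`(d f)(m_0, …, m_n) = ψ^{m_0} f(m_1, …, m_n) + ∑_{i=1}^n (-1)^i f(m_0, …, m_{i-1} m_i, …, m_n) +
(-1)^{n+1} f(m_0, …, m_{n-1}) ψ^{m_n}`.  The summation index below is `i - 1`. -/
def d (n : ℕ) : Fun R n →+ Fun R (n + 1) where
  toFun f m :=
    adams R (m 0) * f (fun j => m j.succ) +
      ∑ i : Fin n, (-1 : ℤ) ^ (i + 1 : ℕ) • f (Fin.contractNth i.castSucc (· * ·) m) +
      (-1 : ℤ) ^ (n + 1) • (f (fun j => m j.castSucc) * adams R (m (Fin.last n)))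
  map_zero' := by ext; simp
  map_add' f g := by
    funext m
    simp only [Pi.add_apply, mul_add, add_mul, smul_add, Finset.sum_add_distrib]
    abel

/-- The cocycles in `F^n`. -/
def cocycles (n : ℕ) : AddSubgroup (Fun R n) := cochains R n ⊓ (d R n).ker

/-- The image of `F^{n-1}` under the differential (zero for `n = 0`). -/
def coboundaries : (n : ℕ) → AddSubgroup (Fun R n)
  | 0 => ⊥
  | n + 1 => (cochains R n).map (d R n)

/-- The `λ`-ring cohomology group `H^n_λ(R)`: the cocycles in `F^n` modulo those of the form `d g`
with `g` in `F^{n-1}`. -/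
abbrev H (n : ℕ) : Type _ := cocycles R n ⧸ (coboundaries R n).addSubgroupOf (cocycles R n)

end Complex

/-! ### The composition product -/

section Product

variable {R : Type*} [CommRing R]

/-- The composition product of cochains,
`(f ∘ g)(m_1, …, m_{n+k}) = f(m_1, …, m_n) ∘ g(m_{n+1}, …, m_{n+k})`. -/
def comp {n k : ℕ} (f : Fun R n) (g : Fun R k) : Fun R (n + k) := fun m =>
  f (fun i => m (Fin.castAdd k i)) * g (fun j => m (Fin.natAdd n j))

theorem comp_add {n k : ℕ} (f : Fun R n) (g g' : Fun R k) :
    comp f (g + g') = comp f g + comp f g' := by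
  funext m; simp [comp, mul_add]

theorem add_comp {n k : ℕ} (f f' : Fun R n) (g : Fun R k) :
    comp (f + f') g = comp f g + comp f' g := by
  funext m; simp [comp, add_mul]

theorem comp_zero_zero (f g : Fun R 0) : (comp f g : Fun R 0) ![] = f ![] * g ![] := by
  have h0 : ∀ m : Fin 0 → ℕ+, m = ![] := fun m => Subsingleton.elim _ _
  exact congrArg₂ (fun u v => f u * g v) (h0 _) (h0 _)

theorem comp_zero_one (f : Fun R 0) (g : Fun R 1) (n : ℕ+) :
    (comp f g : Fun R 1) ![n] = f ![] * g ![n] := by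
  have h0 : ∀ m : Fin 0 → ℕ+, m = ![] := fun m => Subsingleton.elim _ _
  refine congrArg₂ (fun u v => f u * g v) (h0 _) ?_
  ext j; fin_cases j; rfl

theorem comp_one_zero (f : Fun R 1) (g : Fun R 0) (n : ℕ+) :
    (comp f g : Fun R 1) ![n] = f ![n] * g ![] := by
  have h0 : ∀ m : Fin 0 → ℕ+, m = ![] := fun m => Subsingleton.elim _ _
  refine congrArg₂ (fun u v => f u * g v) ?_ (h0 _)
  ext j; fin_cases j; rfl

theorem fun_zero_ext {f g : Fun R 0} (h : f ![] = g ![]) : f = g := by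
  funext m
  rw [Subsingleton.elim m ![], h]

theorem fun_one_ext {f g : Fun R 1} (h : ∀ n, f ![n] = g ![n]) : f = g := by
  funext m
  have hm : m = ![m 0] := by ext j; fin_cases j; rfl
  rw [hm, h]

variable [LambdaRing R]

/-- The composition product descends to cohomology in bidegree `(n, k)`. -/
structure Descends (R : Type*) [CommRing R] [LambdaRing R] (n k : ℕ) : Prop where
  mem : ∀ f ∈ cocycles R n, ∀ g ∈ cocycles R k, comp f g ∈ cocycles R (n + k)
  left : ∀ f ∈ cocycles R n, f ∈ coboundaries R n → ∀ g ∈ cocycles R k,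
    comp f g ∈ coboundaries R (n + k)
  right : ∀ f ∈ cocycles R n, ∀ g ∈ cocycles R k, g ∈ coboundaries R k →
    comp f g ∈ coboundaries R (n + k)

/-- The product `[f] ∘ [g] = [f ∘ g]` on cohomology. -/
def cup {n k : ℕ} (h : Descends R n k) : H R n →+ H R k →+ H R (n + k) :=
  QuotientAddGroup.lift _
    (AddMonoidHom.mk' (fun f => QuotientAddGroup.lift _
      (AddMonoidHom.mk' (fun g => (QuotientAddGroup.mk
          ⟨comp f.1 g.1, h.mem f.1 f.2 g.1 g.2⟩ : H R (n + k)))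
        (fun g g' => by
          rw [← QuotientAddGroup.mk_add]
          exact congrArg _ (Subtype.ext (comp_add _ _ _))))
      (fun g hg => (QuotientAddGroup.eq_zero_iff _).2 (h.right f.1 f.2 g.1 g.2 hg)))
      (fun f f' => by
        ext g
        change (QuotientAddGroup.mk _ : H R (n + k)) = QuotientAddGroup.mk _ + QuotientAddGroup.mk _
        rw [← QuotientAddGroup.mk_add]
        exact congrArg _ (Subtype.ext (add_comp _ _ _))))
    (fun f hf => by
      ext g
      exact (QuotientAddGroup.eq_zero_iff _).2 (h.left f.1 f.2 hf g.1 g.2))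

theorem d_zero_apply (f : Fun R 0) (m : Fin 1 → ℕ+) :
    d R 0 f m = adams R (m 0) * f ![] - f ![] * adams R (m 0) := by
  have h0 : ∀ m : Fin 0 → ℕ+, m = ![] := fun m => Subsingleton.elim _ _
  simp [d, h0, sub_eq_add_neg]

theorem d_one_apply (f : Fun R 1) (m : Fin 2 → ℕ+) :
    d R 1 f m = adams R (m 0) * f ![m 1] - f ![m 0 * m 1] + f ![m 0] * adams R (m 1) := by
  have h1 : (fun j : Fin 1 => m j.succ) = ![m 1] := by ext j; fin_cases j; rfl
  have h2 : (fun j : Fin 1 => m j.castSucc) = ![m 0] := by ext j; fin_cases j; rfl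
  have h3 : (Fin.contractNth (Fin.castSucc 0) (· * ·) m : Fin 1 → ℕ+) = ![m 0 * m 1] := by
    ext j; fin_cases j; rfl
  simp only [d, AddMonoidHom.coe_mk, ZeroHom.coe_mk, h1, h2, h3, Fin.sum_univ_one]
  simp [sub_eq_add_neg]

theorem mem_cocycles_zero (f : Fun R 0) :
    f ∈ cocycles R 0 ↔ f ![] ∈ endBar R ∧ ∀ n, adams R n * f ![] = f ![] * adams R n := by
  refine and_congr Iff.rfl ?_
  change d R 0 f = 0 ↔ _
  constructor
  · intro h n
    have := congrFun h ![n]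
    rw [d_zero_apply] at this
    exact sub_eq_zero.1 this
  · intro h
    funext m
    rw [d_zero_apply, h, sub_self]; rfl

theorem mem_cocycles_one (f : Fun R 1) :
    f ∈ cocycles R 1 ↔ f ∈ cochains R 1 ∧
      ∀ m n, adams R m * f ![n] - f ![m * n] + f ![m] * adams R n = 0 := by
  refine and_congr Iff.rfl ?_
  change d R 1 f = 0 ↔ _
  constructor
  · intro h m n
    have := congrFun h ![m, n]
    rwa [d_one_apply] at this
  · intro h
    funext m
    rw [d_one_apply, h]; rfl

theorem mem_coboundaries_one (f : Fun R 1) :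
    f ∈ coboundaries R 1 ↔
      ∃ g ∈ endBar R, ∀ n, f ![n] = adams R n * g - g * adams R n := by
  constructor
  · rintro ⟨g, hg, rfl⟩
    exact ⟨g ![], hg, fun n => d_zero_apply g ![n]⟩
  · rintro ⟨g, hg, h⟩
    refine ⟨fun _ => g, hg, ?_⟩
    funext m
    have hm : m = ![m 0] := by ext j; fin_cases j; rfl
    rw [d_zero_apply, hm, h]; rfl

theorem descends_zero_zero : Descends R 0 0 where
  mem f hf g hg := by
    rw [mem_cocycles_zero] at hf hg
    refine (mem_cocycles_zero (comp f g)).2 ?_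
    rw [comp_zero_zero]
    refine ⟨mul_mem hf.1 hg.1, fun n => ?_⟩
    rw [← mul_assoc, hf.2, mul_assoc, hg.2, mul_assoc]
  left f _ h g _ := by
    obtain rfl : f = 0 := h
    refine (show comp 0 g = 0 from ?_)
    funext m; simp [comp]
  right f _ g _ h := by
    obtain rfl : g = 0 := h
    refine (show comp f 0 = 0 from ?_)
    funext m; simp [comp]

theorem descends_zero_one : Descends R 0 1 where
  mem f hf g hg := by
    rw [mem_cocycles_zero] at hf
    rw [mem_cocycles_one] at hg
    refine (mem_cocycles_one (comp f g)).2 ⟨fun p hp r => ?_, fun m n => ?_⟩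
    · rw [comp_zero_one]
      obtain ⟨c, hc⟩ := hg.1 p hp r
      refine ⟨f ![] c, ?_⟩
      rw [Module.End.mul_apply, hc, ← nsmul_eq_mul, map_nsmul, nsmul_eq_mul]
    · simp only [comp_zero_one]
      rw [← mul_assoc, hf.2, mul_assoc, mul_assoc, ← mul_sub, ← mul_add, hg.2, mul_zero]
  left f _ h g _ := by
    obtain rfl : f = 0 := h
    have : comp (0 : Fun R 0) g = 0 := by funext m; simp [comp]
    rw [this]; exact zero_mem _
  right f hf g _ h := by
    rw [mem_cocycles_zero] at hf
    obtain ⟨e, he, h⟩ := (mem_coboundaries_one g).1 h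
    refine (mem_coboundaries_one (comp f g)).2 ⟨f ![] * e, mul_mem hf.1 he, fun n => ?_⟩
    rw [comp_zero_one, h, mul_sub, ← mul_assoc, ← hf.2, mul_assoc, mul_assoc]

theorem descends_one_zero : Descends R 1 0 where
  mem f hf g hg := by
    rw [mem_cocycles_zero] at hg
    rw [mem_cocycles_one] at hf
    refine (mem_cocycles_one (comp f g)).2 ⟨fun p hp r => ?_, fun m n => ?_⟩
    · rw [comp_one_zero]
      exact hf.1 p hp (g ![] r)
    · simp only [comp_one_zero]
      rw [mul_assoc (f ![m]), ← hg.2, ← mul_assoc, ← mul_assoc, ← sub_mul, ← add_mul, hf.2,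
        zero_mul]
  left f _ h g hg := by
    rw [mem_cocycles_zero] at hg
    obtain ⟨e, he, h⟩ := (mem_coboundaries_one f).1 h
    refine (mem_coboundaries_one (comp f g)).2 ⟨e * g ![], mul_mem he hg.1, fun n => ?_⟩
    rw [comp_one_zero, h, sub_mul, mul_assoc, mul_assoc, hg.2, mul_assoc]
  right f _ g _ h := by
    obtain rfl : g = 0 := h
    have : comp f (0 : Fun R 0) = 0 := by funext m; simp [comp]
    rw [this]; exact zero_mem _

variable (R) in
/-- The cohomology class of the identity map of `R`. -/
def classId : H R 0 :=
  QuotientAddGroup.mk ⟨fun _ => 1, (mem_cocycles_zero _).2 ⟨one_mem _, fun n => by simp⟩⟩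

/-- The product `H^0 × H^0 → H^0`. -/
def mul00 : H R 0 →+ H R 0 →+ H R 0 := cup descends_zero_zero

/-- The product `H^0 × H^1 → H^1`. -/
def mul01 : H R 0 →+ H R 1 →+ H R 1 := cup descends_zero_one

/-- The product `H^1 × H^0 → H^1`. -/
def mul10 : H R 1 →+ H R 0 →+ H R 1 := cup descends_one_zero

theorem mul_assoc_000 (a : H R 0) (b : H R 0) (c : H R 0) :
    mul00 (mul00 a b) c = mul00 a (mul00 b c) := by
  induction a using QuotientAddGroup.induction_on with | _ a => ?_
  induction b using QuotientAddGroup.induction_on with | _ b => ?_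
  induction c using QuotientAddGroup.induction_on with | _ c => ?_
  refine congrArg (QuotientAddGroup.mk (s := (coboundaries R 0).addSubgroupOf (cocycles R 0)))
    (Subtype.ext (fun_zero_ext ?_))
  exact ((comp_zero_zero (comp a.1 b.1) c.1).trans
      (congrArg (· * _) (comp_zero_zero a.1 b.1))).trans
    ((mul_assoc _ _ _).trans
      ((comp_zero_zero a.1 (comp b.1 c.1)).trans
        (congrArg (_ * ·) (comp_zero_zero b.1 c.1))).symm)

theorem mul_assoc_001 (a : H R 0) (b : H R 0) (c : H R 1) :
    mul01 (mul00 a b) c = mul01 a (mul01 b c) := by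
  induction a using QuotientAddGroup.induction_on with | _ a => ?_
  induction b using QuotientAddGroup.induction_on with | _ b => ?_
  induction c using QuotientAddGroup.induction_on with | _ c => ?_
  refine congrArg (QuotientAddGroup.mk (s := (coboundaries R 1).addSubgroupOf (cocycles R 1)))
    (Subtype.ext (fun_one_ext fun n => ?_))
  exact ((comp_zero_one (comp a.1 b.1) c.1 n).trans
      (congrArg (· * _) (comp_zero_zero a.1 b.1))).trans
    ((mul_assoc _ _ _).trans
      ((comp_zero_one a.1 (comp b.1 c.1) n).trans
        (congrArg (_ * ·) (comp_zero_one b.1 c.1 n))).symm)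

theorem mul_assoc_010 (a : H R 0) (b : H R 1) (c : H R 0) :
    mul10 (mul01 a b) c = mul01 a (mul10 b c) := by
  induction a using QuotientAddGroup.induction_on with | _ a => ?_
  induction b using QuotientAddGroup.induction_on with | _ b => ?_
  induction c using QuotientAddGroup.induction_on with | _ c => ?_
  refine congrArg (QuotientAddGroup.mk (s := (coboundaries R 1).addSubgroupOf (cocycles R 1)))
    (Subtype.ext (fun_one_ext fun n => ?_))
  exact ((comp_one_zero (comp a.1 b.1) c.1 n).trans
      (congrArg (· * _) (comp_zero_one a.1 b.1 n))).trans
    ((mul_assoc _ _ _).trans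
      ((comp_zero_one a.1 (comp b.1 c.1) n).trans
        (congrArg (_ * ·) (comp_one_zero b.1 c.1 n))).symm)

theorem mul_assoc_100 (a : H R 1) (b : H R 0) (c : H R 0) :
    mul10 (mul10 a b) c = mul10 a (mul00 b c) := by
  induction a using QuotientAddGroup.induction_on with | _ a => ?_
  induction b using QuotientAddGroup.induction_on with | _ b => ?_
  induction c using QuotientAddGroup.induction_on with | _ c => ?_
  refine congrArg (QuotientAddGroup.mk (s := (coboundaries R 1).addSubgroupOf (cocycles R 1)))
    (Subtype.ext (fun_one_ext fun n => ?_))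
  exact ((comp_one_zero (comp a.1 b.1) c.1 n).trans
      (congrArg (· * _) (comp_one_zero a.1 b.1 n))).trans
    ((mul_assoc _ _ _).trans
      ((comp_one_zero a.1 (comp b.1 c.1) n).trans
        (congrArg (_ * ·) (comp_zero_zero b.1 c.1))).symm)

theorem classId_mul00 (a : H R 0) : mul00 (classId R) a = a := by
  induction a using QuotientAddGroup.induction_on with | _ a => ?_
  refine congrArg (QuotientAddGroup.mk (s := (coboundaries R 0).addSubgroupOf (cocycles R 0)))
    (Subtype.ext (fun_zero_ext ?_))
  exact (comp_zero_zero (fun _ => 1) a.1).trans (one_mul _)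

theorem mul00_classId (a : H R 0) : mul00 a (classId R) = a := by
  induction a using QuotientAddGroup.induction_on with | _ a => ?_
  refine congrArg (QuotientAddGroup.mk (s := (coboundaries R 0).addSubgroupOf (cocycles R 0)))
    (Subtype.ext (fun_zero_ext ?_))
  exact (comp_zero_zero a.1 (fun _ => 1)).trans (mul_one _)

theorem classId_mul01 (a : H R 1) : mul01 (classId R) a = a := by
  induction a using QuotientAddGroup.induction_on with | _ a => ?_
  refine congrArg (QuotientAddGroup.mk (s := (coboundaries R 1).addSubgroupOf (cocycles R 1)))
    (Subtype.ext (fun_one_ext fun n => ?_))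
  exact (comp_zero_one (fun _ => 1) a.1 n).trans (one_mul _)

theorem mul10_classId (a : H R 1) : mul10 a (classId R) = a := by
  induction a using QuotientAddGroup.induction_on with | _ a => ?_
  refine congrArg (QuotientAddGroup.mk (s := (coboundaries R 1).addSubgroupOf (cocycles R 1)))
    (Subtype.ext (fun_one_ext fun n => ?_))
  exact (comp_one_zero a.1 (fun _ => 1) n).trans (mul_one _)

end Product

/-! ### The graded algebra `H^{≤ 1}` -/

section HLeOne

variable (R : Type*) [CommRing R] [LambdaRing R]

/-- `H^{≤ 1}_λ(R) = H^0_λ(R) ⊕ H^1_λ(R)`. -/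
def HLeOne : Type _ := H R 0 × H R 1

namespace HLeOne

instance : AddCommGroup (HLeOne R) := inferInstanceAs (AddCommGroup (H R 0 × H R 1))

variable {R}

/-- The product is the composition product, where products of two classes of degree `1`, being of
degree `2`, are zero. -/
instance : Mul (HLeOne R) where
  mul u v := (mul00 u.1 v.1, mul01 u.1 v.2 + mul10 u.2 v.1)

instance : One (HLeOne R) where
  one := (classId R, 0)

theorem ext {u v : HLeOne R} (h1 : u.1 = v.1) (h2 : u.2 = v.2) : u = v := Prod.ext h1 h2

theorem fst_zero : (0 : HLeOne R).1 = 0 := rfl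
theorem snd_zero : (0 : HLeOne R).2 = 0 := rfl
theorem fst_one : (1 : HLeOne R).1 = classId R := rfl
theorem snd_one : (1 : HLeOne R).2 = 0 := rfl
theorem fst_add (u v : HLeOne R) : (u + v).1 = u.1 + v.1 := rfl
theorem snd_add (u v : HLeOne R) : (u + v).2 = u.2 + v.2 := rfl
theorem fst_mul (u v : HLeOne R) : (u * v).1 = mul00 u.1 v.1 := rfl
theorem snd_mul (u v : HLeOne R) : (u * v).2 = mul01 u.1 v.2 + mul10 u.2 v.1 := rfl

instance : Ring (HLeOne R) where
  __ := (inferInstance : AddCommGroup (HLeOne R))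
  left_distrib u v w := by
    apply ext
    · simp only [fst_mul, fst_add, map_add]
    · simp only [snd_mul, fst_add, snd_add, map_add]; abel
  right_distrib u v w := by
    apply ext
    · simp only [fst_mul, fst_add, map_add, AddMonoidHom.add_apply]
    · simp only [snd_mul, fst_add, snd_add, map_add, AddMonoidHom.add_apply]; abel
  zero_mul u := by
    apply ext
    · simp only [fst_mul, fst_zero, map_zero, AddMonoidHom.zero_apply]
    · simp only [snd_mul, fst_zero, snd_zero, map_zero, AddMonoidHom.zero_apply, add_zero]
  mul_zero u := by
    apply ext
    · simp only [fst_mul, fst_zero, map_zero]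
    · simp only [snd_mul, fst_zero, snd_zero, map_zero, add_zero]
  mul_assoc u v w := by
    apply ext
    · simp only [fst_mul, mul_assoc_000]
    · simp only [snd_mul, fst_mul, map_add, AddMonoidHom.add_apply, mul_assoc_001, mul_assoc_010,
        mul_assoc_100, add_assoc]
  one_mul u := by
    apply ext
    · simp only [fst_mul, fst_one, classId_mul00]
    · simp only [snd_mul, fst_one, snd_one, classId_mul01, map_zero, AddMonoidHom.zero_apply,
        add_zero]
  mul_one u := by
    apply ext
    · simp only [fst_mul, fst_one, mul00_classId]
    · simp only [snd_mul, fst_one, snd_one, mul10_classId, map_zero, zero_add]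

variable (R) in
/-- The homogeneous elements of degree `n`: `H^0` for `n = 0`, `H^1` for `n = 1`, and zero in all
other degrees. -/
def homogeneous : ℕ → AddSubgroup (HLeOne R)
  | 0 => (AddMonoidHom.snd (H R 0) (H R 1)).ker
  | 1 => (AddMonoidHom.fst (H R 0) (H R 1)).ker
  | _ + 2 => ⊥

end HLeOne

end HLeOne

/-! ### The graded algebra `ℤ ⊕ ℤ ⊕ ∏_p (pℤ ⊕ pℤ)` -/

section PrimeAlgebra

/-- The ideal `pℤ`. -/
abbrev multiples (p : Nat.Primes) : Ideal ℤ := Ideal.span {((p : ℕ) : ℤ)}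

/-- The graded group `(ℤ ⊕ ℤ) ⊕ ∏_p (pℤ ⊕ pℤ)`, the product running over all primes. -/
def PrimeAlgebra : Type := (ℤ × ℤ) × ((p : Nat.Primes) → multiples p × multiples p)

namespace PrimeAlgebra

instance : AddCommGroup PrimeAlgebra :=
  inferInstanceAs (AddCommGroup ((ℤ × ℤ) × ((p : Nat.Primes) → multiples p × multiples p)))

/-- Degree `0` elements multiply coordinatewise and act coordinatewise on degree `1` elements from
either side; products of two elements of degree `1` are zero. -/
instance : Mul PrimeAlgebra where
  mul u v := ((u.1.1 * v.1.1, u.1.2 * v.1.2), fun p =>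
    (u.1.1 • (v.2 p).1 + v.1.1 • (u.2 p).1, u.1.2 • (v.2 p).2 + v.1.2 • (u.2 p).2))

instance : One PrimeAlgebra where
  one := ((1, 1), 0)

theorem ext {u v : PrimeAlgebra} (h1 : u.1.1 = v.1.1) (h2 : u.1.2 = v.1.2)
    (h3 : ∀ p, (u.2 p).1 = (v.2 p).1) (h4 : ∀ p, (u.2 p).2 = (v.2 p).2) : u = v :=
  Prod.ext (Prod.ext h1 h2) (funext fun p => Prod.ext (h3 p) (h4 p))

theorem fst_mul (u v : PrimeAlgebra) : (u * v).1 = (u.1.1 * v.1.1, u.1.2 * v.1.2) := rfl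
theorem snd_mul (u v : PrimeAlgebra) (p : Nat.Primes) : (u * v).2 p =
    (u.1.1 • (v.2 p).1 + v.1.1 • (u.2 p).1, u.1.2 • (v.2 p).2 + v.1.2 • (u.2 p).2) := rfl
theorem fst_add (u v : PrimeAlgebra) : (u + v).1 = (u.1.1 + v.1.1, u.1.2 + v.1.2) := rfl
theorem snd_add (u v : PrimeAlgebra) (p : Nat.Primes) :
    (u + v).2 p = ((u.2 p).1 + (v.2 p).1, (u.2 p).2 + (v.2 p).2) := rfl
theorem fst_zero : (0 : PrimeAlgebra).1 = (0, 0) := rfl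
theorem snd_zero (p : Nat.Primes) : (0 : PrimeAlgebra).2 p = (0, 0) := rfl
theorem fst_one : (1 : PrimeAlgebra).1 = (1, 1) := rfl
theorem snd_one (p : Nat.Primes) : (1 : PrimeAlgebra).2 p = (0, 0) := rfl

instance : CommRing PrimeAlgebra where
  __ := (inferInstance : AddCommGroup PrimeAlgebra)
  mul_comm u v := by
    apply ext
    · simp only [fst_mul]; ring
    · simp only [fst_mul]; ring
    · intro p; simp only [snd_mul]; abel
    · intro p; simp only [snd_mul]; abel
  left_distrib u v w := by
    apply ext
    · simp only [fst_mul, fst_add]; ring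
    · simp only [fst_mul, fst_add]; ring
    · intro p; simp only [snd_mul, snd_add, fst_add]; module
    · intro p; simp only [snd_mul, snd_add, fst_add]; module
  right_distrib u v w := by
    apply ext
    · simp only [fst_mul, fst_add]; ring
    · simp only [fst_mul, fst_add]; ring
    · intro p; simp only [snd_mul, snd_add, fst_add]; module
    · intro p; simp only [snd_mul, snd_add, fst_add]; module
  zero_mul u := by
    apply ext <;> simp [fst_mul, snd_mul, fst_zero, snd_zero]
  mul_zero u := by
    apply ext <;> simp [fst_mul, snd_mul, fst_zero, snd_zero]
  mul_assoc u v w := by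
    apply ext
    · simp only [fst_mul]; ring
    · simp only [fst_mul]; ring
    · intro p; simp only [snd_mul, fst_mul]; module
    · intro p; simp only [snd_mul, fst_mul]; module
  one_mul u := by
    apply ext <;> simp [fst_mul, snd_mul, fst_one, snd_one]
  mul_one u := by
    apply ext <;> simp [fst_mul, snd_mul, fst_one, snd_one]

/-- The element `(a, b)` of degree `0`. -/
def deg0 (a b : ℤ) : PrimeAlgebra := ((a, b), 0)

/-- The element `(x_p, y_p)_p` of degree `1`. -/
def deg1 (x y : (p : Nat.Primes) → multiples p) : PrimeAlgebra := (0, fun p => (x p, y p))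

/-- The homogeneous elements of degree `n`: `ℤ ⊕ ℤ` for `n = 0`, `∏_p (pℤ ⊕ pℤ)` for `n = 1`, and
zero in all other degrees. -/
def homogeneous : ℕ → AddSubgroup PrimeAlgebra
  | 0 => (AddMonoidHom.snd (ℤ × ℤ) ((p : Nat.Primes) → multiples p × multiples p)).ker
  | 1 => (AddMonoidHom.fst (ℤ × ℤ) ((p : Nat.Primes) → multiples p × multiples p)).ker
  | _ + 2 => ⊥

end PrimeAlgebra

end PrimeAlgebra

end LambdaCohomology

/-! Every operator involved turns out to be diagonal in the basis 1, x. Since x² = 0, the universal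
formula for λ^n(x · x), read modulo x, forces n c² = 0 for the constant term c of λ^n(x) once the
lower constant terms vanish (`map_lam_of_mul_self_eq_zero`). So all λ^n(x) with n > 0 lie in the
square-zero ideal (x), Newton's formula collapses to ψ^n(x) = ± n λ^n(x), and ψ^n = diag(1, b_n)
with n ∣ b_n. The formula for λ^i(λ^j(x)) then gives b_{mn} = b_m b_n (`eigen_mul`).

The congruences modulo all primes force the members of `endBar` to be diagonal, and by Fermat every
diagonal map is a member (`mem_endBar_iff`). Diagonal maps commute with each ψ^n, so H^0 is ℤ ⊕ ℤ,
every 1-coboundary is zero, and H^1 is just the group of 1-cocycles.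

A 1-cocycle satisfies f(mn) = ψ^m f(n) + f(m) ψ^n. Each off-diagonal entry g obeys g(mn) = b_m g(n)
+ g(m); comparing g(qp) with g(pq), where p divides b_p and g(p), shows that every prime p divides
g(q), so g = 0 (`eq_zero_of_crossed`). The diagonal entries obey Leibniz rules. They are determined
by their values at primes (`eq_zero_of_leibniz`), which can be prescribed freely (`exists_leibniz`);
the cochain condition only asks that the value at p lie in pℤ. Composition multiplies diagonal
entries, which gives the product and its commutativity. -/

namespace LambdaCohomology

open LambdaRing

/-! ### Complex roots and the polynomial `P_n` evaluated at its top variables -/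

section Roots

open Polynomial

/-- With d^n = -c, the numbers -ζd for ζ running over the n-th roots of unity work. They supply a
point where all elementary symmetric functions of positive degree vanish except the top one, which
is c. -/
theorem exists_prod_one_add_mul_eq {n : ℕ} (hn : 0 < n) (c : ℂ) :
    ∃ ξ : Fin n → ℂ, (∀ m, ξ m ^ n = (-1) ^ (n + 1) * c) ∧
      ∏ m, (1 + C (ξ m) * X : ℂ[X]) = 1 + C c * X ^ n := by
  obtain ⟨d, hd⟩ := IsAlgClosed.exists_pow_nat_eq (-c) hn
  have hζ := Complex.isPrimitiveRoot_exp n hn.ne'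
  have hcard : Fintype.card {z // z ∈ nthRootsFinset n (1 : ℂ)} = n := by
    rw [Fintype.card_coe, hζ.card_nthRootsFinset]
  let t : Fin n ≃ {z // z ∈ nthRootsFinset n (1 : ℂ)} :=
    (Fintype.equivFinOfCardEq hcard).symm
  refine ⟨fun m => -((t m : ℂ) * d), fun m => ?_, ?_⟩
  · have h1 : (t m : ℂ) ^ n = 1 := (mem_nthRootsFinset hn 1).1 (t m).2
    rw [neg_pow, mul_pow, h1, hd, pow_succ]; ring
  · refine Polynomial.funext fun u => ?_
    have h := hζ.pow_sub_pow_eq_prod_sub_mul (x := 1) (y := d * u) hn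
    rw [← Finset.prod_coe_sort, ← Equiv.prod_comp t] at h
    rw [eval_prod]
    calc ∏ m, eval u (1 + C (-((t m : ℂ) * d)) * X)
        = ∏ m, (1 - (t m : ℂ) * (d * u)) := by
          refine Finset.prod_congr rfl fun m _ => ?_
          simp; ring
      _ = eval u (1 + C c * X ^ n) := by
          rw [← h, mul_pow, hd]; simp

theorem aeval_esymm_of_prod_eq {n : ℕ} (c : ℂ) (ξ : Fin n → ℂ)
    (h : ∏ m, (1 + C (ξ m) * X : ℂ[X]) = 1 + C c * X ^ n) (k : Fin n) :
    MvPolynomial.aeval ξ (MvPolynomial.esymm (Fin n) ℤ (k + 1)) =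
      if (k + 1 : ℕ) = n then c else 0 := by
  have h1 := prod_one_add_mul_esymm n ξ 1
  simp only [one_mul] at h1
  rw [h] at h1
  have h2 := congrArg (fun p => coeff p (k + 1)) (add_left_cancel h1)
  simp only [one_pow, mul_one, finsetSum_coeff, coeff_C_mul_X_pow] at h2
  rw [h2, Finset.sum_eq_single k]
  · simp
  · intro b _ hb
    rw [if_neg]
    intro hk; exact hb (Fin.ext (by omega))
  · simp

/-- The polynomial is (1 + aX)^n with X replaced by X^n, so its coefficient at n is the linear
coefficient of (1 + aX)^n. -/
theorem coeff_one_add_C_mul_X_pow_pow {A : Type*} [CommRing A] {n : ℕ} (hn : 0 < n) (a : A) :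
    ((1 + C a * X ^ n : A[X]) ^ n).coeff n = n * a := by
  have h : (1 + C a * X ^ n : A[X]) ^ n = expand A n (((1 + X) ^ n).comp (C a * X)) := by
    simp
  rw [h]
  have h2 := coeff_expand_mul hn (((1 + X : A[X]) ^ n).comp (C a * X)) 1
  rw [one_mul] at h2
  rw [h2, comp_C_mul_X_coeff, coeff_one_add_X_pow]
  simp

/-- The value of `P_n` when all variables of index less than `n` vanish, up to sign. -/
theorem aeval_prodPoly_top {n : ℕ} (hn : 0 < n) (c : ℤ) :
    MvPolynomial.aeval (Sum.elim (fun k : Fin n => if (k + 1 : ℕ) = n then c else 0)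
      (fun k : Fin n => if (k + 1 : ℕ) = n then c else 0)) (prodPoly n) =
    (-1) ^ (n + 1) * n * c ^ 2 := by
  obtain ⟨ξ, hξ, hprod⟩ := exists_prod_one_add_mul_eq hn (c : ℂ)
  have hinj : Function.Injective (algebraMap ℤ ℂ) := Int.cast_injective
  refine hinj ?_
  rw [← MvPolynomial.aeval_algebraMap_apply]
  -- The arguments of `P_n` are recognised as elementary symmetric functions of ξ (used for both
  -- sets of variables), so the defining identity of `P_n` applies.
  have h1 : (algebraMap ℤ ℂ ∘ Sum.elim (fun k : Fin n => if (k + 1 : ℕ) = n then c else 0)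
      (fun k : Fin n => if (k + 1 : ℕ) = n then c else 0)) =
      fun s => MvPolynomial.aeval (Sum.elim ξ ξ) (prodEsymm n s) := by
    funext s
    rcases s with k | k <;>
    · simp only [Function.comp_apply, Sum.elim_inl, Sum.elim_inr, prodEsymm,
        MvPolynomial.aeval_rename, Sum.elim_comp_inl, Sum.elim_comp_inr]
      rw [aeval_esymm_of_prod_eq _ ξ hprod]
      split_ifs <;> simp
  rw [h1, ← MvPolynomial.comp_aeval_apply, aeval_prodPoly, prodCoeff]
  have h2 : ∀ p : Polynomial (MvPolynomial (Fin n ⊕ Fin n) ℤ),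
      MvPolynomial.aeval (Sum.elim ξ ξ) (p.coeff n) =
        (p.map (MvPolynomial.aeval (Sum.elim ξ ξ)).toRingHom).coeff n := by
    intro p; rw [Polynomial.coeff_map]; rfl
  rw [h2]
  simp only [Polynomial.map_prod, Polynomial.map_add, Polynomial.map_one, Polynomial.map_mul,
    Polynomial.map_C, Polynomial.map_X, AlgHom.toRingHom_eq_coe, RingHom.coe_coe, map_mul,
    MvPolynomial.aeval_X, Sum.elim_inl, Sum.elim_inr]
  -- Substituting ξ_m X for X in 1 + cX^n gives a factor independent of m, because ξ_m^n is; the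
  -- double product is therefore an n-th power.
  have h3 : ∀ m, ∏ l, (1 + C (ξ m) * C (ξ l) * X) =
      1 + C ((c : ℂ) * ((-1) ^ (n + 1) * c)) * X ^ n := by
    intro m
    have := congrArg (fun p => p.comp (C (ξ m) * X)) hprod
    simp only [prod_comp, Polynomial.add_comp, Polynomial.one_comp, Polynomial.mul_comp, C_comp,
      X_comp, pow_comp] at this
    rw [mul_pow, ← C_pow, hξ, ← mul_assoc, ← C_mul] at this
    rw [← this]
    refine Finset.prod_congr rfl fun l _ => ?_
    ring
  simp only [h3, Finset.prod_const, Finset.card_univ, Fintype.card_fin]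
  rw [coeff_one_add_C_mul_X_pow_pow hn]
  simp; ring

end Roots

/-! ### λ-operations and Adams operations on elements of square zero -/

section LambdaPart

variable {R : Type*} [CommRing R] [LambdaRing R]

/-- The series ∑ λ^n(0) t^n is an idempotent by additivity and a unit, hence equal to 1. -/
theorem lam_zero_right {n : ℕ} (hn : 0 < n) : lam n (0 : R) = 0 := by
  have hu : IsUnit (lamSeries (0 : R)) := by
    rw [PowerSeries.isUnit_iff_constantCoeff]
    simp [lamSeries, lam_zero, ← PowerSeries.coeff_zero_eq_constantCoeff_apply]
  have h := lamSeries_add (0 : R) 0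
  rw [add_zero] at h
  have h1 : lamSeries (0 : R) = 1 := hu.mul_left_cancel (by rw [← h, mul_one])
  have := congrArg (PowerSeries.coeff n) h1
  simpa [lamSeries, PowerSeries.coeff_one, hn.ne'] using this

/-- Here ∑ λ^n(1) t^n = 1 + t, so `adamsSeries 1` is the inverse of 1 + t, the alternating geometric
series. -/
theorem adamsFun_one {n : ℕ} (hn : 0 < n) : adamsFun n (1 : R) = 1 := by
  have h1 : lamSeries (1 : R) = 1 + PowerSeries.X := by
    ext k
    rcases k with _ | _ | k
    · simp [lamSeries, lam_zero]
    · simp [lamSeries, lam_one, PowerSeries.coeff_one]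
    · simp [lamSeries, lam_apply_one, PowerSeries.coeff_one, PowerSeries.coeff_X]
  have h := lamSeries_mul_adamsSeries (1 : R)
  rw [h1, add_mul, one_mul] at h
  simp only [map_add, PowerSeries.derivative_X] at h
  obtain ⟨m, rfl⟩ : ∃ m, n = m + 1 := ⟨n - 1, by omega⟩
  clear hn
  induction m with
  | zero =>
    have := congrArg (PowerSeries.coeff 0) h
    simpa [adamsSeries] using this
  | succ m ih =>
    have := congrArg (PowerSeries.coeff (m + 1)) h
    simp [adamsSeries, PowerSeries.coeff_succ_X_mul, PowerSeries.coeff_one, ih, pow_succ] at this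
    have h2 : ((-1 : R) ^ m) * (-1) ^ m = 1 := by
      rw [← mul_pow]; simp
    linear_combination (-(-1 : R) ^ m) * this + (1 - adamsFun (m + 1 + 1) (1 : R)) * h2

/-- An element of square zero has `λ`-operations in the kernel of every homomorphism to `ℤ`. -/
theorem map_lam_of_mul_self_eq_zero (c₀ : R →+* ℤ) {y : R} (hy : y * y = 0) {n : ℕ} (hn : 0 < n) :
    c₀ (lam n y) = 0 := by
  induction n using Nat.strong_induction_on with
  | _ n ih =>
  have h := lam_mul n y y
  rw [hy, lam_zero_right hn] at h
  have h2 := congrArg c₀ h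
  rw [map_zero, show c₀ (MvPolynomial.aeval (Sum.elim (fun k : Fin n => lam (k + 1) y)
    (fun k : Fin n => lam (k + 1) y)) (prodPoly n)) = MvPolynomial.aeval
      (fun s => c₀ (Sum.elim (fun k : Fin n => lam (k + 1) y)
        (fun k : Fin n => lam (k + 1) y) s)) (prodPoly n) from
    MvPolynomial.comp_aeval_apply (f := Sum.elim (fun k : Fin n => lam (k + 1) y)
        (fun k : Fin n => lam (k + 1) y)) (φ := c₀.toIntAlgHom) (prodPoly n)] at h2
  -- By the induction hypothesis only the variables of top index n survive under `c₀`, so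
  -- `aeval_prodPoly_top` leaves ± n c² = 0.
  have h3 : (fun s => c₀ (Sum.elim (fun k : Fin n => lam (k + 1 : ℕ) y)
        (fun k : Fin n => lam (k + 1) y) s)) =
      Sum.elim (fun k : Fin n => if (k + 1 : ℕ) = n then c₀ (lam n y) else 0)
      (fun k : Fin n => if (k + 1 : ℕ) = n then c₀ (lam n y) else 0) := by
    funext s
    rcases s with k | k <;>
    · simp only [Sum.elim_inl, Sum.elim_inr]
      split_ifs with hk
      · rw [hk]
      · exact ih (k + 1) (by omega) (by omega)
  rw [h3, aeval_prodPoly_top hn] at h2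
  simpa [hn.ne'] using h2.symm

/-- On elements of square zero the Adams operations are multiples of the `λ`-operations. -/
theorem adamsFun_of_mul_self_eq_zero (c₀ : R →+* ℤ) (hc : ∀ u v, c₀ u = 0 → c₀ v = 0 → u * v = 0)
    {y : R} (hy : y * y = 0) {n : ℕ} (hn : 0 < n) :
    adamsFun n y = (-1) ^ (n + 1) * n * lam n y := by
  induction n using Nat.strong_induction_on with
  | _ n ih =>
  rw [adamsFun, Finset.sum_eq_zero, add_zero, pow_succ]
  · ring
  · intro i _
    -- Both factors of each middle term in Newton's formula lie in the kernel of `c₀`, whose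
    -- products vanish; for the Adams factor this uses the induction hypothesis.
    rw [mul_assoc, hc _ (adamsFun _ y), mul_zero]
    · exact map_lam_of_mul_self_eq_zero c₀ hy (Nat.succ_pos _)
    · rw [ih _ (by omega) (by omega), map_mul, map_lam_of_mul_self_eq_zero c₀ hy (by omega),
        mul_zero]

end LambdaPart

/-! ### Composition of λ-operations through power sums -/

section Composition

open MvPolynomial

/-- A permutation of the variables merely permutes the family `g`, and the symmetry of `p` absorbs
that permutation. -/
theorem isSymmetric_aeval {σ τ : Type*} {g : σ → MvPolynomial τ ℤ}
    (hg : ∀ e : Equiv.Perm τ, ∃ e' : Equiv.Perm σ, ∀ s, rename e (g s) = g (e' s))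
    {p : MvPolynomial σ ℤ} (hp : p.IsSymmetric) : (aeval g p).IsSymmetric := by
  intro e
  obtain ⟨e', he'⟩ := hg e
  calc rename e (aeval g p) = aeval (fun s => rename e (g s)) p := comp_aeval_apply _ _ _
    _ = aeval g (rename e' p) := by rw [aeval_rename]; simp only [he']; rfl
    _ = aeval g p := by rw [hp e']

theorem coeff_prod_one_add_C_mul_X {σ A : Type*} [Fintype σ] [CommRing A] [Algebra ℤ A]
    (g : σ → A) (i : ℕ) :
    (∏ s, (1 + Polynomial.C (g s) * Polynomial.X)).coeff i = aeval g (esymm σ ℤ i) := by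
  classical
  rw [Finset.prod_one_add, Polynomial.finsetSum_coeff, esymm, map_sum,
    Finset.powersetCard_eq_filter, Finset.sum_filter]
  refine Finset.sum_congr rfl fun t _ => ?_
  rw [Finset.prod_mul_distrib, Finset.prod_const, ← map_prod, Polynomial.coeff_C_mul_X_pow]
  simp [eq_comm]

variable {R : Type*} [CommRing R]

/-- Newton's identities modulo products. -/
theorem eq_mul_of_newton {A : Type*} [CommRing A] (φ : A →+* R) (c₀ : R →+* ℤ)
    (hc : ∀ u v, c₀ u = 0 → c₀ v = 0 → u * v = 0) (E P : ℕ → A) (hE0 : E 0 = 1)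
    (hE : ∀ k, 0 < k → c₀ (φ (E k)) = 0) (hP : ∀ k, 0 < k → c₀ (φ (P k)) = 0)
    (hN : ∀ k : ℕ, k * E k = (-1) ^ (k + 1) *
      ∑ a ∈ Finset.HasAntidiagonal.antidiagonal k with a.1 < k, (-1) ^ a.1 * E a.1 * P a.2)
    {n : ℕ} (hn : 0 < n) : φ (P n) = (-1) ^ (n + 1) * n * φ (E n) := by
  have h := congrArg φ (hN n)
  -- Only the term E_0 P_n survives: every other one contains a product of two elements killed by
  -- `c₀`.
  rw [map_mul, map_mul, map_sum, Finset.sum_eq_single (0, n)] at h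
  · have h2 : ((-1 : R) ^ (n + 1)) * (-1) ^ (n + 1) = 1 := by
      rw [← mul_pow]; simp
    simp only [map_natCast, map_pow, map_neg, map_one, pow_zero, hE0, one_mul] at h
    rw [mul_assoc, h, ← mul_assoc, h2, one_mul]
  · rintro ⟨a, b⟩ hab hne
    simp only [Finset.mem_filter, Finset.HasAntidiagonal.mem_antidiagonal] at hab
    have ha : a ≠ 0 := by
      rintro rfl
      exact hne (by rw [← hab.1, zero_add])
    dsimp only
    rw [mul_assoc, map_mul, map_mul, hc _ _ (hE a (by omega)) (hP b (by omega)), mul_zero]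
  · intro h0
    exact absurd (by simp [hn]) h0

/-- Newton's identities for the family `g`, transported along `φ`. With zero constant terms, power
sums and elementary functions of positive degree land in the kernel of `c₀`, so products disappear.
Allowing any family stable under permutations covers variables, their powers and squarefree
monomials alike. -/
theorem map_psum_eq_mul_esymm {σ τ : Type*} [Fintype σ] {g : σ → MvPolynomial τ ℤ}
    (hg : ∀ e : Equiv.Perm τ, ∃ e' : Equiv.Perm σ, ∀ s, rename e (g s) = g (e' s))
    (hg0 : ∀ s, constantCoeff (g s) = 0) (φ : symmetricSubalgebra τ ℤ →+* R) (c₀ : R →+* ℤ)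
    (hc : ∀ u v, c₀ u = 0 → c₀ v = 0 → u * v = 0)
    (hφ : ∀ f : symmetricSubalgebra τ ℤ, c₀ (φ f) = constantCoeff (f : MvPolynomial τ ℤ))
    {n : ℕ} (hn : 0 < n) :
    φ ⟨aeval g (psum σ ℤ n), isSymmetric_aeval hg (psum_isSymmetric σ ℤ n)⟩ =
      (-1) ^ (n + 1) * n *
        φ ⟨aeval g (esymm σ ℤ n), isSymmetric_aeval hg (esymm_isSymmetric σ ℤ n)⟩ := by
  refine eq_mul_of_newton φ c₀ hc
    (fun n => ⟨aeval g (esymm σ ℤ n), isSymmetric_aeval hg (esymm_isSymmetric σ ℤ n)⟩)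
    (fun n => ⟨aeval g (psum σ ℤ n), isSymmetric_aeval hg (psum_isSymmetric σ ℤ n)⟩)
    ?_ ?_ ?_ ?_ hn
  · exact Subtype.ext (by simp)
  · intro k hk
    rw [hφ]
    simp only [esymm, map_sum, map_prod, aeval_X]
    refine Finset.sum_eq_zero fun t ht => ?_
    simp only [hg0]
    rw [Finset.prod_const, (Finset.mem_powersetCard.1 ht).2, zero_pow hk.ne']
  · intro k hk
    rw [hφ]
    simp [psum, hg0, hk.ne']
  · intro k
    refine Subtype.ext ?_
    have := congrArg (aeval g) (mul_esymm_eq_sum σ ℤ k)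
    simpa using this

/-- Let `φ` send e_k to λ^k(y). Modulo products, p_{ij}(X) is ± ij e_{ij}(X). It also equals
p_j(X^i), which is ± j e_j(X^i). Now e_j(X^i) is the i-th power sum of the squarefree monomials of
degree j, hence ± i times their e_i, and `φ` takes that e_i to λ^i(λ^j(y)). Both sides are thus the
image of one power sum. -/
theorem natCast_mul_lam_lam [LambdaRing R] (c₀ : R →+* ℤ)
    (hc : ∀ u v, c₀ u = 0 → c₀ v = 0 → u * v = 0) {y : R} (hy : y * y = 0) {i j : ℕ}
    (hi : 0 < i) (hj : 0 < j) :
    (-1) ^ (j + 1) * j * ((-1) ^ (i + 1) * i * lam i (lam j y)) =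
      (-1) ^ (i * j + 1) * (i * j : ℕ) * lam (i * j) y := by
  classical
  have hij : 0 < i * j := Nat.mul_pos hi hj
  -- The elementary symmetric polynomials generate the symmetric ones freely, so their images may be
  -- chosen at will.
  let φ : symmetricSubalgebra (Fin (i * j)) ℤ →+* R :=
    ((aeval fun k : Fin (i * j) => lam (k + 1) y).comp
      (esymmAlgEquiv (R := ℤ) (Fin (i * j)) (Fintype.card_fin _)).symm.toAlgHom).toRingHom
  have hφE : ∀ q : MvPolynomial (Fin (i * j)) ℤ, ∀ h,
      φ ⟨aeval (fun k : Fin (i * j) => esymm (Fin (i * j)) ℤ (k + 1)) q, h⟩ =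
        aeval (fun k : Fin (i * j) => lam (k + 1) y) q := by
    intro q h
    have h1 : (⟨aeval (fun k : Fin (i * j) => esymm (Fin (i * j)) ℤ (k + 1)) q, h⟩ :
        symmetricSubalgebra (Fin (i * j)) ℤ) =
        esymmAlgEquiv (R := ℤ) (Fin (i * j)) (Fintype.card_fin _) q :=
      Subtype.ext (esymmAlgHom_apply q).symm
    rw [h1]
    exact congrArg (aeval fun k : Fin (i * j) => lam (k + 1) y) (AlgEquiv.symm_apply_apply
      (esymmAlgEquiv (R := ℤ) (Fin (i * j)) (Fintype.card_fin _)) q)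
  -- Both sides are ring homomorphisms in `f`, so it is enough to check the elementary symmetric
  -- polynomials, where both vanish.
  have hφ : ∀ f : symmetricSubalgebra (Fin (i * j)) ℤ,
      c₀ (φ f) = constantCoeff (f : MvPolynomial (Fin (i * j)) ℤ) := by
    intro f
    obtain ⟨q, rfl⟩ := (esymmAlgEquiv (R := ℤ) (Fin (i * j)) (Fintype.card_fin _)).surjective f
    have h1 : c₀.comp (φ.comp
        (esymmAlgEquiv (R := ℤ) (Fin (i * j)) (Fintype.card_fin _)).toRingEquiv.toRingHom) =
        (constantCoeff.comp (symmetricSubalgebra (Fin (i * j)) ℤ).val.toRingHom).comp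
        (esymmAlgEquiv (R := ℤ) (Fin (i * j)) (Fintype.card_fin _)).toRingEquiv.toRingHom := by
      refine MvPolynomial.ringHom_ext (fun r => by simp) fun k => ?_
      have h2 : esymmAlgEquiv (R := ℤ) (Fin (i * j)) (Fintype.card_fin _) (X k) =
          ⟨esymm (Fin (i * j)) ℤ (k + 1), esymm_isSymmetric _ _ _⟩ := by
        refine Subtype.ext ((esymmAlgHom_apply (X k)).trans (aeval_X _ _))
      have h3 := hφE (X k) (by rw [aeval_X]; exact esymm_isSymmetric _ _ _)
      simp only [aeval_X] at h3
      change c₀ (φ (esymmAlgEquiv (R := ℤ) (Fin (i * j)) (Fintype.card_fin _) (X k))) =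
        constantCoeff (esymmAlgEquiv (R := ℤ) (Fin (i * j)) (Fintype.card_fin _) (X k)).1
      rw [h2, h3, map_lam_of_mul_self_eq_zero c₀ hy (Nat.succ_pos _)]
      simp only [esymm, map_sum, map_prod, constantCoeff_X]
      refine (Finset.sum_eq_zero fun t ht => ?_).symm
      rw [Finset.prod_const, (Finset.mem_powersetCard.1 ht).2, zero_pow (Nat.succ_ne_zero _)]
    exact DFunLike.congr_fun h1 q
  have hX : ∀ e : Equiv.Perm (Fin (i * j)), ∃ e' : Equiv.Perm (Fin (i * j)),
      ∀ s, rename e (X s : MvPolynomial (Fin (i * j)) ℤ) = X (e' s) := fun e => ⟨e, by simp⟩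
  have hXi : ∀ e : Equiv.Perm (Fin (i * j)), ∃ e' : Equiv.Perm (Fin (i * j)),
      ∀ s, rename e (X s ^ i : MvPolynomial (Fin (i * j)) ℤ) = X (e' s) ^ i := fun e => ⟨e, by simp⟩
  have hS : ∀ e : Equiv.Perm (Fin (i * j)),
      ∃ e' : Equiv.Perm {s // s ∈ Finset.powersetCard j (Finset.univ : Finset (Fin (i * j)))},
      ∀ s, rename e (∏ l ∈ s.1, X l : MvPolynomial (Fin (i * j)) ℤ) = ∏ l ∈ (e' s).1, X l := by
    intro e
    refine ⟨e.finsetCongr.subtypeEquiv fun s => ?_, fun s => ?_⟩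
    · simp [Finset.mem_powersetCard]
    · simp
  have n1 := map_psum_eq_mul_esymm hX (by simp) φ c₀ hc hφ hij
  have n2 := map_psum_eq_mul_esymm hXi (by simp [hi.ne']) φ c₀ hc hφ hj
  have n3 := map_psum_eq_mul_esymm hS (fun s => by
    rw [map_prod]
    simp only [constantCoeff_X]
    rw [Finset.prod_const, (Finset.mem_powersetCard.1 s.2).2, zero_pow hj.ne']) φ c₀ hc hφ hi
  have t1 : aeval (fun s : Fin (i * j) => (X s : MvPolynomial (Fin (i * j)) ℤ))
      (psum (Fin (i * j)) ℤ (i * j)) =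
      aeval (fun s : Fin (i * j) => (X s ^ i : MvPolynomial (Fin (i * j)) ℤ))
      (psum (Fin (i * j)) ℤ j) := by
    simp [psum, pow_mul]
  have t2 : aeval (fun s : Fin (i * j) => (X s ^ i : MvPolynomial (Fin (i * j)) ℤ))
      (esymm (Fin (i * j)) ℤ j) =
      aeval (fun s : {s // s ∈ Finset.powersetCard j (Finset.univ : Finset (Fin (i * j)))} =>
        (∏ l ∈ s.1, X l : MvPolynomial (Fin (i * j)) ℤ)) (psum _ ℤ i) := by
    simp only [psum, esymm, map_sum, map_prod, map_pow, aeval_X]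
    rw [← Finset.sum_coe_sort]
    exact Finset.sum_congr rfl fun s _ => Finset.prod_pow _ _ _
  have t3 : aeval (fun s : {s // s ∈ Finset.powersetCard j (Finset.univ : Finset (Fin (i * j)))} =>
        (∏ l ∈ s.1, X l : MvPolynomial (Fin (i * j)) ℤ)) (esymm _ ℤ i) =
      aeval (fun k : Fin (i * j) => esymm (Fin (i * j)) ℤ (k + 1)) (compPoly i j) := by
    rw [aeval_compPoly, ← coeff_prod_one_add_C_mul_X, compCoeff]
    exact congrArg (Polynomial.coeff · i) (Finset.prod_coe_sort _
      fun s => 1 + Polynomial.C (∏ l ∈ s, X l : MvPolynomial (Fin (i * j)) ℤ) * Polynomial.X)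
  -- The variable with index k stands for e_{k+1}, hence the index ij - 1 for e_{ij}.
  have t4 : aeval (fun s : Fin (i * j) => (X s : MvPolynomial (Fin (i * j)) ℤ))
      (esymm (Fin (i * j)) ℤ (i * j)) =
      aeval (fun k : Fin (i * j) => esymm (Fin (i * j)) ℤ (k + 1))
        (X (⟨i * j - 1, Nat.sub_lt hij Nat.one_pos⟩ : Fin (i * j)) :
          MvPolynomial (Fin (i * j)) ℤ) := by
    rw [aeval_X]
    simp only [Nat.sub_add_cancel (Nat.succ_le_of_lt hij)]
    exact aeval_X_left_apply (esymm (Fin (i * j)) ℤ (i * j))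
  simp only [t4, hφE] at n1
  simp only [aeval_X, Nat.sub_add_cancel (Nat.succ_le_of_lt hij)] at n1
  simp only [t2] at n2
  simp only [t3, hφE, ← lam_lam] at n3
  rw [← n3, ← n2, ← n1]
  simp only [t1]

end Composition

/-! ### Integer-valued functions on the multiplicative monoid of positive integers -/

section Integers

/-- Some prime exceeds |z|. -/
theorem eq_zero_of_forall_prime_dvd {z : ℤ} (h : ∀ p : ℕ, p.Prime → (p : ℤ) ∣ z) : z = 0 := by
  obtain ⟨p, hp, hpp⟩ := Nat.exists_infinite_primes (z.natAbs + 1)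
  exact Int.eq_zero_of_dvd_of_natAbs_lt_natAbs (h p hpp) (by rw [Int.natAbs_natCast]; omega)

theorem prime_dvd_pow_sub_self {p : ℕ} (hp : p.Prime) (z : ℤ) : (p : ℤ) ∣ z ^ p - z := by
  have := Fact.mk hp
  rw [← ZMod.intCast_zmod_eq_zero_iff_dvd]
  simp

theorem pnat_induction_on_primes {P : ℕ+ → Prop} (h1 : P 1) (hp : ∀ p : ℕ+, (p : ℕ).Prime → P p)
    (hm : ∀ m n, P m → P n → P (m * n)) (n : ℕ+) : P n := by
  have h : ∀ k : ℕ, ∀ hk : 0 < k, P ⟨k, hk⟩ := by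
    intro k
    induction k using Nat.recOnMul with
    | zero => exact fun hk => absurd hk (lt_irrefl 0)
    | one => exact fun _ => h1
    | prime p hpp => exact fun hk => hp ⟨p, hk⟩ hpp
    | mul a b iha ihb =>
      intro hk
      exact hm ⟨a, Nat.pos_of_mul_pos_right hk⟩ ⟨b, Nat.pos_of_mul_pos_left hk⟩ (iha _) (ihb _)
  exact h n n.pos

/-- A derivation on the positive integers with values in `ℤ` twisted by a multiplicative function
may be prescribed arbitrarily on primes. -/
theorem exists_leibniz {b : ℕ+ → ℤ} (b1 : b 1 = 1) (bm : ∀ m n, b (m * n) = b m * b n)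
    (y : Nat.Primes → ℤ) : ∃ δ : ℕ+ → ℤ, (∀ m n, δ (m * n) = b m * δ n + δ m * b n) ∧
      ∀ p : Nat.Primes, δ p = y p := by
  -- The Leibniz rule for δ says that n ↦ b_n + δ_n ε is multiplicative. Since the positive integers
  -- are the free commutative monoid on the primes, such a map can be defined by its values b_p +
  -- y_p ε.
  let g : Nat.Primes → DualNumber ℤ := fun p =>
    TrivSqZeroExt.inl (b p) + TrivSqZeroExt.inr (y p)
  let F : ℕ+ → DualNumber ℤ := fun n => (Multiset.map g (PNat.factorMultiset n)).prod
  have F1 : F 1 = 1 := by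
    change (Multiset.map g (PNat.factorMultiset 1)).prod = 1
    rw [PNat.factorMultiset_one]
    exact Multiset.prod_zero
  have Fm : ∀ m n, F (m * n) = F m * F n := by
    intro m n
    change (Multiset.map g (PNat.factorMultiset (m * n))).prod = _
    rw [PNat.factorMultiset_mul]
    exact (congrArg Multiset.prod (Multiset.map_add g _ _)).trans (Multiset.prod_add _ _)
  have Fp : ∀ p : Nat.Primes, F p = g p := by
    intro p
    change (Multiset.map g (PNat.factorMultiset p)).prod = _
    rw [PNat.factorMultiset_ofPrime]
    exact (congrArg Multiset.prod (Multiset.map_singleton g p)).trans (Multiset.prod_singleton _)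
  have Fb : ∀ n, (F n).fst = b n := by
    refine pnat_induction_on_primes ?_ (fun p hp => ?_) fun m n hm hn => ?_
    · rw [F1, b1]; rfl
    · obtain ⟨q, rfl⟩ : ∃ q : Nat.Primes, (q : ℕ+) = p := by
        let q : Nat.Primes := ⟨(p : ℕ), hp⟩
        exact ⟨q, PNat.eq rfl⟩
      rw [Fp]
      simp [g]
    · rw [Fm, TrivSqZeroExt.fst_mul, hm, hn, bm]
  refine ⟨fun n => (F n).snd, fun m n => ?_, fun p => ?_⟩
  · simp only [Fm, TrivSqZeroExt.snd_mul, Fb, smul_eq_mul, MulOpposite.smul_eq_mul_unop,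
      MulOpposite.unop_op]
  · simp [Fp, g]

theorem eq_zero_of_leibniz {b δ : ℕ+ → ℤ} (b1 : b 1 = 1)
    (h : ∀ m n, δ (m * n) = b m * δ n + δ m * b n) (hp : ∀ p : ℕ+, (p : ℕ).Prime → δ p = 0)
    (n : ℕ+) : δ n = 0 := by
  refine pnat_induction_on_primes (P := fun n => δ n = 0) ?_ hp (fun m n hm hn => ?_) n
  · have := h 1 1
    rw [mul_one, b1] at this
    linarith
  · rw [h, hm, hn]; ring

/-- The rule is asymmetric in m and n although mn = nm. Comparing both orders gives g(q) = b_p g(q)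
+ g(p) - b_q g(p), so every prime p divides g(q). -/
theorem eq_zero_of_crossed {b g : ℕ+ → ℤ} (b1 : b 1 = 1)
    (hb : ∀ p : ℕ+, (p : ℕ).Prime → ((p : ℕ) : ℤ) ∣ b p)
    (h : ∀ m n, g (m * n) = b m * g n + g m)
    (hg : ∀ p : ℕ+, (p : ℕ).Prime → ((p : ℕ) : ℤ) ∣ g p) (n : ℕ+) : g n = 0 := by
  refine pnat_induction_on_primes (P := fun n => g n = 0) ?_ (fun q _ => ?_) (fun m n hm hn => ?_) n
  · have := h 1 1
    rw [mul_one, b1] at this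
    linarith
  · refine eq_zero_of_forall_prime_dvd fun p hp => ?_
    obtain ⟨P, rfl⟩ : ∃ P : ℕ+, (P : ℕ) = p := ⟨⟨p, hp.pos⟩, rfl⟩
    obtain ⟨u, hu⟩ := hb P hp
    obtain ⟨v, hv⟩ := hg P hp
    have h2 := h q P
    rw [mul_comm q P, h, hu, hv] at h2
    exact ⟨u * g q + v - b q * v, by linear_combination -h2⟩
  · rw [h, hm, hn]; ring

end Integers

/-- Coordinates on a ring of dual numbers over `ℤ`: every element is `c₀ r + c₁ r x`, where
`x ^ 2 = 0`. -/
structure DualCoordinates (R : Type*) [CommRing R] where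
  x : R
  c₀ : R →+* ℤ
  c₁ : R →+ ℤ
  c₀_x : c₀ x = 0
  c₁_x : c₁ x = 1
  c₁_one : c₁ 1 = 0
  x_mul_x : x * x = 0
  eq_add : ∀ r, r = c₀ r • (1 : R) + c₁ r • x

/-- The coordinates given by an isomorphism with the dual numbers. -/
noncomputable def DualCoordinates.ofRingEquiv {R : Type*} [CommRing R] (e : R ≃+* DualNumber ℤ) :
    DualCoordinates R where
  x := e.symm DualNumber.eps
  c₀ := (TrivSqZeroExt.fstHom ℤ ℤ ℤ).toRingHom.comp e.toRingHom
  c₁ := (TrivSqZeroExt.sndHom ℤ ℤ).toAddMonoidHom.comp e.toAddEquiv.toAddMonoidHom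
  c₀_x := by simp
  c₁_x := by simp
  c₁_one := by simp
  x_mul_x := by rw [← map_mul, DualNumber.eps_mul_eps, map_zero]
  eq_add r := by
    apply e.injective
    rw [map_add, map_zsmul, map_zsmul, map_one, RingEquiv.apply_symm_apply]
    ext <;> simp

/-! ### Diagonal endomorphisms and the eigenvalues of the Adams operations -/

namespace DualCoordinates

variable {R : Type*} [CommRing R] (B : DualCoordinates R)

theorem ext {r s : R} (h₀ : B.c₀ r = B.c₀ s) (h₁ : B.c₁ r = B.c₁ s) : r = s := by
  rw [B.eq_add r, B.eq_add s, h₀, h₁]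

theorem c₁_mul (r s : R) : B.c₁ (r * s) = B.c₀ r * B.c₁ s + B.c₁ r * B.c₀ s := by
  conv_lhs => rw [B.eq_add r, B.eq_add s]
  have h : (B.c₀ r • (1 : R) + B.c₁ r • B.x) * (B.c₀ s • (1 : R) + B.c₁ s • B.x) =
      (B.c₀ r * B.c₀ s) • (1 : R) + (B.c₀ r * B.c₁ s + B.c₁ r * B.c₀ s) • B.x := by
    simp only [zsmul_eq_mul]
    push_cast
    linear_combination (B.c₁ r * B.c₁ s : R) * B.x_mul_x
  rw [h, map_add, map_zsmul, map_zsmul, B.c₁_one, B.c₁_x]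
  simp

theorem mul_eq_zero_of_c₀ (u v : R) (hu : B.c₀ u = 0) (hv : B.c₀ v = 0) : u * v = 0 :=
  B.ext (by simp [hu]) (by simp [c₁_mul, hu, hv])

theorem c₁_pow (r : R) (n : ℕ) : B.c₁ (r ^ n) = n * (B.c₀ r ^ (n - 1) * B.c₁ r) := by
  induction n with
  | zero => simp [B.c₁_one]
  | succ n ih =>
    rw [pow_succ, c₁_mul, ih, map_pow]
    rcases n with _ | n
    · simp
    · simp only [Nat.add_sub_cancel, pow_succ]; push_cast; ring

theorem natCast_dvd_iff (n : ℕ) (r : R) :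
    (n : R) ∣ r ↔ (n : ℤ) ∣ B.c₀ r ∧ (n : ℤ) ∣ B.c₁ r := by
  constructor
  · rintro ⟨s, rfl⟩
    rw [← nsmul_eq_mul, map_nsmul, map_nsmul, nsmul_eq_mul, nsmul_eq_mul]
    exact ⟨dvd_mul_right _ _, dvd_mul_right _ _⟩
  · rintro ⟨⟨u, hu⟩, v, hv⟩
    refine ⟨u • (1 : R) + v • B.x, ?_⟩
    rw [B.eq_add r, hu, hv]
    simp only [zsmul_eq_mul]
    push_cast
    ring

theorem end_ext {f g : Module.End ℤ R} (h₀ : f 1 = g 1) (h₁ : f B.x = g B.x) : f = g := by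
  ext r
  rw [B.eq_add r, map_add, map_add, map_zsmul, map_zsmul, map_zsmul, map_zsmul, h₀, h₁]

/-- The diagonal endomorphism with `1 ↦ a`, `x ↦ b x`. -/
def diag (a b : ℤ) : Module.End ℤ R :=
  (AddMonoidHom.mk' (fun r => (a * B.c₀ r) • (1 : R) + (b * B.c₁ r) • B.x) (fun r s => by
    simp only [map_add, mul_add, add_smul]; abel)).toIntLinearMap

theorem diag_apply (a b : ℤ) (r : R) :
    B.diag a b r = (a * B.c₀ r) • (1 : R) + (b * B.c₁ r) • B.x := rfl

theorem c₀_diag (a b : ℤ) (r : R) : B.c₀ (B.diag a b r) = a * B.c₀ r := by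
  simp [diag_apply, B.c₀_x]

theorem c₁_diag (a b : ℤ) (r : R) : B.c₁ (B.diag a b r) = b * B.c₁ r := by
  rw [diag_apply, map_add, map_zsmul, map_zsmul, B.c₁_one, B.c₁_x]
  simp

theorem diag_one_right (a b : ℤ) : B.diag a b 1 = a • (1 : R) := by
  simp [diag_apply, B.c₁_one]

theorem diag_x (a b : ℤ) : B.diag a b B.x = b • B.x := by
  simp [diag_apply, B.c₀_x, B.c₁_x]

theorem diag_mul (a b a' b' : ℤ) : B.diag a b * B.diag a' b' = B.diag (a * a') (b * b') := by
  ext r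
  refine B.ext ?_ ?_
  · simp only [Module.End.mul_apply, c₀_diag]; ring
  · simp only [Module.End.mul_apply, c₁_diag]; ring

theorem diag_add (a b a' b' : ℤ) : B.diag a b + B.diag a' b' = B.diag (a + a') (b + b') := by
  ext r
  refine B.ext ?_ ?_
  · simp only [LinearMap.add_apply, map_add, c₀_diag]; ring
  · simp only [LinearMap.add_apply, map_add, c₁_diag]; ring

theorem diag_zero_zero : B.diag 0 0 = 0 := by
  ext r
  simp [diag_apply]

theorem eq_diag {f : Module.End ℤ R} (h₁ : B.c₁ (f 1) = 0) (h₀ : B.c₀ (f B.x) = 0) :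
    f = B.diag (B.c₀ (f 1)) (B.c₁ (f B.x)) := by
  refine B.end_ext (B.ext ?_ ?_) (B.ext ?_ ?_)
  · simp [c₀_diag]
  · simp [c₁_diag, h₁, B.c₁_one]
  · simp [c₀_diag, h₀, B.c₀_x]
  · simp [c₁_diag, B.c₁_x]

/-- At r = 1 the x-coordinate of f(1)^p is a multiple of p, so p divides that of f(1). At r = x the
right side f(x^p) is zero, so p divides the constant term of f(x). Letting p vary kills both
off-diagonal entries. -/
theorem mem_endBar_iff (f : Module.End ℤ R) : f ∈ endBar R ↔ ∃ a b, f = B.diag a b := by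
  constructor
  · intro hf
    have hf' : ∀ p : ℕ, p.Prime → ∀ r : R, (p : R) ∣ f r ^ p - f (r ^ p) := hf
    refine ⟨_, _, B.eq_diag (eq_zero_of_forall_prime_dvd fun p hp => ?_)
      (eq_zero_of_forall_prime_dvd fun p hp => ?_)⟩
    · have h := ((B.natCast_dvd_iff p _).1 (hf' p hp 1)).2
      rw [one_pow, map_sub, c₁_pow] at h
      exact (dvd_sub_right (dvd_mul_right _ _)).1 h
    · have h := ((B.natCast_dvd_iff p _).1 (hf' p hp B.x)).1
      have hx : B.x ^ p = 0 := by
        obtain ⟨k, rfl⟩ := Nat.exists_eq_add_of_le hp.two_le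
        rw [pow_add, pow_two, B.x_mul_x, zero_mul]
      rw [hx, map_zero, sub_zero, map_pow] at h
      exact (Nat.prime_iff_prime_int.1 hp).dvd_of_dvd_pow h
  · rintro ⟨a, b, rfl⟩ p hp r
    rw [B.natCast_dvd_iff]
    constructor
    · rw [map_sub, map_pow, c₀_diag, c₀_diag, map_pow, mul_pow, ← sub_mul]
      exact (prime_dvd_pow_sub_self hp a).mul_right _
    · rw [map_sub, c₁_pow, c₁_diag, c₁_diag, c₁_pow]
      exact dvd_sub (dvd_mul_right _ _) ((dvd_mul_right _ _).mul_left _)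

/-- The diagonal entries of a `0`-cochain. -/
def entriesZero : Fun R 0 →+ ℤ × ℤ where
  toFun f := (B.c₀ (f ![] 1), B.c₁ (f ![] B.x))
  map_zero' := by simp
  map_add' f g := by simp

theorem entriesZero_eq {f : Fun R 0} {a b : ℤ} (h : f ![] = B.diag a b) :
    B.entriesZero f = (a, b) := by
  refine Prod.ext ?_ ?_
  · simp [entriesZero, h, c₀_diag]
  · simp [entriesZero, h, c₁_diag, B.c₁_x]

variable [LambdaRing R]

/-- The eigenvalue of `ψ^n` on `x`. -/
def eigen (n : ℕ+) : ℤ := B.c₁ (adams R n B.x)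

theorem adams_x (n : ℕ+) : adams R n B.x = (-1) ^ (n + 1 : ℕ) * (n : ℕ) * lam n B.x :=
  adamsFun_of_mul_self_eq_zero B.c₀ B.mul_eq_zero_of_c₀ B.x_mul_x n.pos

theorem c₀_lam_x (n : ℕ+) : B.c₀ (lam n B.x) = 0 :=
  map_lam_of_mul_self_eq_zero B.c₀ B.x_mul_x n.pos

theorem adams_eq_diag (n : ℕ+) : adams R n = B.diag 1 (B.eigen n) := by
  have h1 : adams R n 1 = 1 := adamsFun_one n.pos
  have h := B.eq_diag (f := adams R n) (by rw [h1, B.c₁_one])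
    (by rw [adams_x, map_mul, c₀_lam_x, mul_zero])
  rwa [h1, map_one] at h

theorem eigen_one : B.eigen 1 = 1 := by
  simp [eigen, adams_x, lam_one, B.c₁_x]

theorem dvd_eigen (n : ℕ+) : ((n : ℕ) : ℤ) ∣ B.eigen n := by
  refine ((B.natCast_dvd_iff n _).1 ?_).2
  rw [adams_x]
  exact (dvd_mul_left _ _).mul_right _

/-- This is ψ^m ψ^n = ψ^{mn} on x. As λ^n(x) again has square zero, ψ^m on it is ± m λ^m, and
`natCast_mul_lam_lam` finishes. -/
theorem eigen_mul (m n : ℕ+) : B.eigen (m * n) = B.eigen m * B.eigen n := by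
  have h0 := B.c₀_lam_x n
  have h : adams R m (adams R n B.x) = adams R (m * n) B.x := by
    rw [adams_x, adams_x]
    -- Written as an integer multiple, the factor passes through the ℤ-linear map ψ^m.
    have h1 : ((-1 : R) ^ (n + 1 : ℕ) * (n : ℕ) * lam n B.x) =
        ((-1 : ℤ) ^ (n + 1 : ℕ) * (n : ℕ)) • lam n B.x := by simp
    have h2 : adams R m (lam n B.x) = _ := adamsFun_of_mul_self_eq_zero B.c₀ B.mul_eq_zero_of_c₀
      (B.mul_eq_zero_of_c₀ _ _ h0 h0) m.pos
    rw [h1, map_zsmul, h2]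
    have h3 := natCast_mul_lam_lam B.c₀ B.mul_eq_zero_of_c₀ B.x_mul_x m.pos n.pos
    rw [PNat.mul_coe, ← h3]
    simp
  have h4 := congrArg B.c₁ h
  rw [B.adams_eq_diag m, c₁_diag] at h4
  exact h4.symm

end DualCoordinates

/-! ### Cocycles, the groups `H^0` and `H^1`, and their products -/

namespace DualCoordinates

variable {R : Type*} [CommRing R] [LambdaRing R] (B : DualCoordinates R)

theorem exists_diag_of_mem_cocycles_zero {f : Fun R 0} (hf : f ∈ cocycles R 0) :
    ∃ a b, f ![] = B.diag a b :=
  (B.mem_endBar_iff _).1 ((mem_cocycles_zero f).1 hf).1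

theorem const_diag_mem_cocycles_zero (a b : ℤ) : (fun _ => B.diag a b) ∈ cocycles R 0 := by
  refine (mem_cocycles_zero _).2 ⟨(B.mem_endBar_iff _).2 ⟨a, b, rfl⟩, fun n => ?_⟩
  rw [adams_eq_diag B, diag_mul, diag_mul, mul_comm a, mul_comm b]

/-- A coboundary is a commutator of diagonal maps. -/
theorem eq_zero_of_mem_coboundaries_one (B : DualCoordinates R) {f : Fun R 1} (hf : f ∈ coboundaries R 1) : f = 0 := by
  obtain ⟨g, hg, h⟩ := (mem_coboundaries_one f).1 hf
  obtain ⟨a, b, rfl⟩ := (B.mem_endBar_iff _).1 hg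
  refine fun_one_ext fun n => ?_
  rw [h, adams_eq_diag B, diag_mul, diag_mul, mul_comm a, mul_comm b, sub_self]
  rfl

/-- The values of a `1`-cocycle are diagonal, the entries being derivations. -/
theorem exists_diag_of_mem_cocycles_one {f : Fun R 1} (hf : f ∈ cocycles R 1) :
    ∃ α δ : ℕ+ → ℤ, (∀ n, f ![n] = B.diag (α n) (δ n)) ∧ (∀ m n, α (m * n) = 1 * α n + α m * 1) ∧
      ∀ m n, δ (m * n) = B.eigen m * δ n + δ m * B.eigen n := by
  obtain ⟨hp, h⟩ := (mem_cocycles_one f).1 hf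
  have hp' : ∀ p : ℕ+, (p : ℕ).Prime → ∀ r : R, ((p : ℕ) : R) ∣ f ![p] r := hp
  have hr : ∀ m n r, f ![m * n] r =
      B.diag 1 (B.eigen m) (f ![n] r) + f ![m] (B.diag 1 (B.eigen n) r) := by
    intro m n r
    have := LinearMap.congr_fun (h m n) r
    simp only [LinearMap.add_apply, LinearMap.sub_apply, Module.End.mul_apply,
      LinearMap.zero_apply, adams_eq_diag B] at this
    linear_combination -this
  have h1 : ∀ m n, f ![m * n] 1 = B.diag 1 (B.eigen m) (f ![n] 1) + f ![m] 1 := by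
    intro m n
    rw [hr, diag_one_right, one_smul]
  have hx : ∀ m n, f ![m * n] B.x =
      B.diag 1 (B.eigen m) (f ![n] B.x) + B.eigen n • f ![m] B.x := by
    intro m n
    rw [hr, diag_x, map_zsmul]
  have hγ : ∀ n, B.c₁ (f ![n] 1) = 0 := by
    refine eq_zero_of_crossed B.eigen_one (fun p _ => B.dvd_eigen p) (fun m n => ?_)
      fun p hpp => ((B.natCast_dvd_iff _ _).1 (hp' p hpp 1)).2
    rw [h1, map_add, c₁_diag]
  have hβ : ∀ n, B.c₀ (f ![n] B.x) = 0 := by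
    refine eq_zero_of_crossed B.eigen_one (fun p _ => B.dvd_eigen p) (fun m n => ?_)
      fun p hpp => ((B.natCast_dvd_iff _ _).1 (hp' p hpp B.x)).1
    -- For this entry the eigenvalue multiplies f(m) instead of f(n); swapping m and n gives the
    -- form required by `eq_zero_of_crossed`.
    rw [mul_comm m n, hx, map_add, c₀_diag, map_zsmul, smul_eq_mul]
    ring
  refine ⟨fun n => B.c₀ (f ![n] 1), fun n => B.c₁ (f ![n] B.x), fun n => B.eq_diag (hγ n) (hβ n),
    fun m n => ?_, fun m n => ?_⟩
  · simp only [h1, map_add, c₀_diag, mul_one]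
  · simp only [hx, map_add, c₁_diag, map_zsmul, smul_eq_mul]
    ring

theorem diag_mem_cocycles_one {α δ : ℕ+ → ℤ} (hα : ∀ m n, α (m * n) = 1 * α n + α m * 1)
    (hδ : ∀ m n, δ (m * n) = B.eigen m * δ n + δ m * B.eigen n)
    (hαp : ∀ p : ℕ+, (p : ℕ).Prime → ((p : ℕ) : ℤ) ∣ α p)
    (hδp : ∀ p : ℕ+, (p : ℕ).Prime → ((p : ℕ) : ℤ) ∣ δ p) :
    (fun m => B.diag (α (m 0)) (δ (m 0))) ∈ cocycles R 1 := by
  refine (mem_cocycles_one _).2 ⟨fun p hp r => ?_, fun m n => ?_⟩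
  · rw [B.natCast_dvd_iff, c₀_diag, c₁_diag]
    exact ⟨(hαp p hp).mul_right _, (hδp p hp).mul_right _⟩
  · simp only [Matrix.cons_val_zero, adams_eq_diag B, diag_mul]
    rw [sub_add_eq_add_sub, diag_add, hα, hδ, sub_self]

theorem entries_mem_multiples {f : Fun R 1} (hf : f ∈ cocycles R 1) (p : Nat.Primes) (r : R) :
    B.c₀ (f ![(p : ℕ+)] r) ∈ multiples p ∧ B.c₁ (f ![(p : ℕ+)] r) ∈ multiples p := by
  have h := ((mem_cocycles_one f).1 hf).1 (p : ℕ+) p.2 r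
  rw [Ideal.mem_span_singleton, Ideal.mem_span_singleton]
  exact (B.natCast_dvd_iff _ _).1 h

/-- The diagonal entries of a `1`-cocycle at the primes. -/
def entriesOne : cocycles R 1 →+ ((p : Nat.Primes) → multiples p × multiples p) where
  toFun f p := (⟨B.c₀ (f.1 ![(p : ℕ+)] 1), (B.entries_mem_multiples f.2 p 1).1⟩,
    ⟨B.c₁ (f.1 ![(p : ℕ+)] B.x), (B.entries_mem_multiples f.2 p B.x).2⟩)
  map_zero' := by
    funext p
    exact Prod.ext (Subtype.ext (by simp)) (Subtype.ext (by simp))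
  map_add' f g := by
    funext p
    exact Prod.ext (Subtype.ext (by simp)) (Subtype.ext (by simp))

theorem entriesOne_fst {f : cocycles R 1} {p : Nat.Primes} {a b : ℤ}
    (h : f.1 ![(p : ℕ+)] = B.diag a b) : ((B.entriesOne f p).1 : ℤ) = a := by
  change B.c₀ (f.1 ![(p : ℕ+)] 1) = a
  simp [h, c₀_diag]

theorem entriesOne_snd {f : cocycles R 1} {p : Nat.Primes} {a b : ℤ}
    (h : f.1 ![(p : ℕ+)] = B.diag a b) : ((B.entriesOne f p).2 : ℤ) = b := by
  change B.c₁ (f.1 ![(p : ℕ+)] B.x) = b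
  simp [h, c₁_diag, B.c₁_x]

/-- `H^0 ≅ ℤ ⊕ ℤ`. -/
noncomputable def equivZero : H R 0 ≃+ ℤ × ℤ :=
  AddEquiv.ofBijective
    (QuotientAddGroup.lift _ (B.entriesZero.comp (cocycles R 0).subtype) (fun f hf => by
      have h0 : f.1 = 0 := hf
      change B.entriesZero f.1 = 0
      rw [h0, map_zero])) <| by
    constructor
    · refine (injective_iff_map_eq_zero _).2 fun u hu => ?_
      induction u using QuotientAddGroup.induction_on with | _ f => ?_
      have hu' : B.entriesZero f.1 = 0 := hu
      obtain ⟨a, b, h⟩ := B.exists_diag_of_mem_cocycles_zero f.2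
      rw [B.entriesZero_eq h, Prod.mk_eq_zero] at hu'
      rw [hu'.1, hu'.2, diag_zero_zero] at h
      exact congrArg _ (Subtype.ext (fun_zero_ext h) : f = 0)
    · rintro ⟨a, b⟩
      exact ⟨QuotientAddGroup.mk ⟨_, B.const_diag_mem_cocycles_zero a b⟩,
        B.entriesZero_eq (f := fun _ => B.diag a b) rfl⟩

theorem equivZero_mk (f : cocycles R 0) :
    B.equivZero (QuotientAddGroup.mk f) = B.entriesZero f.1 := rfl

/-- `H^1 ≅ ∏_p (pℤ ⊕ pℤ)`. -/
noncomputable def equivOne : H R 1 ≃+ ((p : Nat.Primes) → multiples p × multiples p) :=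
  AddEquiv.ofBijective
    (QuotientAddGroup.lift _ B.entriesOne (fun f hf => by
      have h0 : f = 0 := Subtype.ext (B.eq_zero_of_mem_coboundaries_one hf)
      rw [h0]
      exact zero_mem _)) <| by
    have hprime : ∀ p : ℕ+, (p : ℕ).Prime → ∃ q : Nat.Primes, (q : ℕ+) = p := fun p hp => by
      let q : Nat.Primes := ⟨(p : ℕ), hp⟩
      exact ⟨q, PNat.eq rfl⟩
    constructor
    · refine (injective_iff_map_eq_zero _).2 fun u hu => ?_
      induction u using QuotientAddGroup.induction_on with | _ f => ?_
      have hu' : B.entriesOne f = 0 := hu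
      obtain ⟨α, δ, h, hα, hδ⟩ := B.exists_diag_of_mem_cocycles_one f.2
      -- The twist is 1 here because ψ^n fixes 1; for δ it is the eigenvalue on x.
      have hα0 := eq_zero_of_leibniz (b := fun _ => 1) rfl hα fun p hp => by
        obtain ⟨q, rfl⟩ := hprime p hp
        rw [← B.entriesOne_fst (h q), hu']; rfl
      have hδ0 := eq_zero_of_leibniz B.eigen_one hδ fun p hp => by
        obtain ⟨q, rfl⟩ := hprime p hp
        rw [← B.entriesOne_snd (h q), hu']; rfl
      refine congrArg _ (Subtype.ext (fun_one_ext fun n => ?_) : f = 0)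
      rw [h, hα0, hδ0, diag_zero_zero]; rfl
    · intro z
      obtain ⟨α, hα, hαp⟩ := exists_leibniz (b := fun _ => 1) rfl (fun _ _ => rfl)
        fun p => ((z p).1 : ℤ)
      obtain ⟨δ, hδ, hδp⟩ := exists_leibniz B.eigen_one B.eigen_mul fun p => ((z p).2 : ℤ)
      have hmem := B.diag_mem_cocycles_one hα hδ
        (fun p hp => by
          obtain ⟨q, rfl⟩ := hprime p hp
          rw [hαp]
          exact Ideal.mem_span_singleton.1 (z q).1.2)
        (fun p hp => by
          obtain ⟨q, rfl⟩ := hprime p hp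
          rw [hδp]
          exact Ideal.mem_span_singleton.1 (z q).2.2)
      refine ⟨QuotientAddGroup.mk ⟨_, hmem⟩, ?_⟩
      change B.entriesOne ⟨_, hmem⟩ = z
      funext p
      exact Prod.ext (Subtype.ext ((B.entriesOne_fst rfl).trans (hαp p)))
        (Subtype.ext ((B.entriesOne_snd rfl).trans (hδp p)))

theorem equivOne_mk (f : cocycles R 1) :
    B.equivOne (QuotientAddGroup.mk f) = B.entriesOne f := rfl

theorem equivZero_mul00 (u v : H R 0) :
    B.equivZero (mul00 u v) = B.equivZero u * B.equivZero v := by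
  induction u using QuotientAddGroup.induction_on with | _ f => ?_
  induction v using QuotientAddGroup.induction_on with | _ g => ?_
  obtain ⟨a, b, hf⟩ := B.exists_diag_of_mem_cocycles_zero f.2
  obtain ⟨c, d, hg⟩ := B.exists_diag_of_mem_cocycles_zero g.2
  rw [equivZero_mk, equivZero_mk, B.entriesZero_eq hf, B.entriesZero_eq hg]
  exact B.entriesZero_eq (f := (comp f.1 g.1 : Fun R 0))
    ((comp_zero_zero f.1 g.1).trans (by rw [hf, hg, diag_mul]))

theorem equivOne_mul01 (u : H R 0) (v : H R 1) (p : Nat.Primes) :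
    B.equivOne (mul01 u v) p =
      ((B.equivZero u).1 • (B.equivOne v p).1, (B.equivZero u).2 • (B.equivOne v p).2) := by
  induction u using QuotientAddGroup.induction_on with | _ f => ?_
  induction v using QuotientAddGroup.induction_on with | _ g => ?_
  obtain ⟨a, b, hf⟩ := B.exists_diag_of_mem_cocycles_zero f.2
  obtain ⟨α, δ, hg, -, -⟩ := B.exists_diag_of_mem_cocycles_one g.2
  have h : (comp f.1 g.1 : Fun R 1) ![(p : ℕ+)] = B.diag (a * α p) (b * δ p) :=
    (comp_zero_one f.1 g.1 p).trans (by rw [hf, hg, diag_mul])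
  rw [equivZero_mk, equivOne_mk, B.entriesZero_eq hf]
  refine Prod.ext (Subtype.ext ?_) (Subtype.ext ?_)
  · refine (B.entriesOne_fst (f := ⟨_, descends_zero_one.mem f.1 f.2 g.1 g.2⟩) h).trans ?_
    rw [← B.entriesOne_fst (hg p)]; rfl
  · refine (B.entriesOne_snd (f := ⟨_, descends_zero_one.mem f.1 f.2 g.1 g.2⟩) h).trans ?_
    rw [← B.entriesOne_snd (hg p)]; rfl

theorem equivOne_mul10 (u : H R 1) (v : H R 0) (p : Nat.Primes) :
    B.equivOne (mul10 u v) p =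
      ((B.equivZero v).1 • (B.equivOne u p).1, (B.equivZero v).2 • (B.equivOne u p).2) := by
  induction u using QuotientAddGroup.induction_on with | _ f => ?_
  induction v using QuotientAddGroup.induction_on with | _ g => ?_
  obtain ⟨a, b, hg⟩ := B.exists_diag_of_mem_cocycles_zero g.2
  obtain ⟨α, δ, hf, -, -⟩ := B.exists_diag_of_mem_cocycles_one f.2
  have h : (comp f.1 g.1 : Fun R 1) ![(p : ℕ+)] = B.diag (a * α p) (b * δ p) :=
    -- Diagonal entries commute, so the right action has the same formula as the left one.
    (comp_one_zero f.1 g.1 p).trans (by rw [hf, hg, diag_mul, mul_comm a, mul_comm b])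
  rw [equivZero_mk, equivOne_mk, B.entriesZero_eq hg]
  refine Prod.ext (Subtype.ext ?_) (Subtype.ext ?_)
  · refine (B.entriesOne_fst (f := ⟨_, descends_one_zero.mem f.1 f.2 g.1 g.2⟩) h).trans ?_
    rw [← B.entriesOne_fst (hf p)]; rfl
  · refine (B.entriesOne_snd (f := ⟨_, descends_one_zero.mem f.1 f.2 g.1 g.2⟩) h).trans ?_
    rw [← B.entriesOne_snd (hf p)]; rfl

/-- The isomorphism of `H^{≤ 1}` with `(ℤ ⊕ ℤ) ⊕ ∏_p (pℤ ⊕ pℤ)`. -/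
noncomputable def equivHLeOne : HLeOne R ≃+* PrimeAlgebra where
  toFun u := (B.equivZero u.1, B.equivOne u.2)
  invFun v := (B.equivZero.symm v.1, B.equivOne.symm v.2)
  left_inv u := HLeOne.ext (B.equivZero.symm_apply_apply u.1) (B.equivOne.symm_apply_apply u.2)
  right_inv v := Prod.ext (B.equivZero.apply_symm_apply v.1) (B.equivOne.apply_symm_apply v.2)
  map_mul' u v := by
    refine Prod.ext (B.equivZero_mul00 u.1 v.1) (funext fun p => ?_)
    change B.equivOne (mul01 u.1 v.2 + mul10 u.2 v.1) p = _
    rw [map_add, Pi.add_apply, equivOne_mul01, equivOne_mul10]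
    rfl
  map_add' u v := Prod.ext (map_add B.equivZero u.1 v.1) (map_add B.equivOne u.2 v.2)

theorem map_homogeneous (n : ℕ) :
    (HLeOne.homogeneous R n).map (B.equivHLeOne : HLeOne R →+ PrimeAlgebra) =
      PrimeAlgebra.homogeneous n := by
  match n with
  | 0 =>
    ext v
    constructor
    · rintro ⟨u, hu, rfl⟩
      have hu' : u.2 = 0 := hu
      change B.equivOne u.2 = 0
      rw [hu', map_zero]
    · intro hv
      have hv' : v.2 = 0 := hv
      refine ⟨B.equivHLeOne.symm v, ?_, B.equivHLeOne.apply_symm_apply v⟩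
      change B.equivOne.symm v.2 = 0
      rw [hv', map_zero]
  | 1 =>
    ext v
    constructor
    · rintro ⟨u, hu, rfl⟩
      have hu' : u.1 = 0 := hu
      change B.equivZero u.1 = 0
      rw [hu', map_zero]
    · intro hv
      have hv' : v.1 = 0 := hv
      refine ⟨B.equivHLeOne.symm v, ?_, B.equivHLeOne.apply_symm_apply v⟩
      change B.equivZero.symm v.1 = 0
      rw [hv', map_zero]
  | _ + 2 => exact AddSubgroup.map_bot _

end DualCoordinates

/-! ### Multiplication in the model algebra -/

namespace PrimeAlgebra

theorem deg0_mul_deg0 (a b c d : ℤ) : deg0 a b * deg0 c d = deg0 (a * c) (b * d) := by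
  refine ext rfl rfl (fun p => ?_) fun p => ?_
  · change a • (0 : multiples p) + c • (0 : multiples p) = 0
    simp
  · change b • (0 : multiples p) + d • (0 : multiples p) = 0
    simp

theorem deg0_mul_deg1 (a b : ℤ) (x y : (p : Nat.Primes) → multiples p) :
    deg0 a b * deg1 x y = deg1 (fun p => a • x p) (fun p => b • y p) := by
  refine ext (mul_zero a) (mul_zero b) (fun p => ?_) fun p => ?_
  · change a • x p + (0 : ℤ) • (0 : multiples p) = a • x p
    simp
  · change b • y p + (0 : ℤ) • (0 : multiples p) = b • y p
    simp

end PrimeAlgebra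

end LambdaCohomology

theorem theorem3p1 {R : Type*} [CommRing R] [LambdaCohomology.FilteredLambdaRing R]
    (e : R ≃+* DualNumber ℤ) :
    (∃ Φ : LambdaCohomology.HLeOne R ≃+* LambdaCohomology.PrimeAlgebra,
      ∀ n : ℕ, (LambdaCohomology.HLeOne.homogeneous R n).map
          (Φ : LambdaCohomology.HLeOne R →+ LambdaCohomology.PrimeAlgebra) =
        LambdaCohomology.PrimeAlgebra.homogeneous n) ∧
    (∀ a b c d : ℤ,
      LambdaCohomology.PrimeAlgebra.deg0 a b * LambdaCohomology.PrimeAlgebra.deg0 c d =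
        LambdaCohomology.PrimeAlgebra.deg0 (a * c) (b * d)) ∧
    (∀ (a b : ℤ) (x y : (p : Nat.Primes) → LambdaCohomology.multiples p),
      LambdaCohomology.PrimeAlgebra.deg0 a b * LambdaCohomology.PrimeAlgebra.deg1 x y =
          LambdaCohomology.PrimeAlgebra.deg1 (fun p => a • x p) (fun p => b • y p) ∧
        LambdaCohomology.PrimeAlgebra.deg1 x y * LambdaCohomology.PrimeAlgebra.deg0 a b =
          LambdaCohomology.PrimeAlgebra.deg1 (fun p => a • x p) (fun p => b • y p)) ∧
    ∀ u v : LambdaCohomology.HLeOne R, u * v = v * u := by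
  let B := LambdaCohomology.DualCoordinates.ofRingEquiv e
  refine ⟨⟨B.equivHLeOne, B.map_homogeneous⟩, LambdaCohomology.PrimeAlgebra.deg0_mul_deg0,
    fun a b x y => ⟨LambdaCohomology.PrimeAlgebra.deg0_mul_deg1 a b x y,
      (mul_comm _ _).trans (LambdaCohomology.PrimeAlgebra.deg0_mul_deg1 a b x y)⟩, fun u v => ?_⟩
  -- Commutativity is pulled back from the commutative ring `PrimeAlgebra`.
  apply B.equivHLeOne.injective
  rw [map_mul, map_mul, mul_comm]
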